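/- Let $I\subseteq\mathbb R$ be a nonempty open interval and consider the equations $$u_t=a(t)^2u_{xx}+b(t)u-c(t)u^3,\qquad t\in I,\tag{1}$$ where $a,b,c$ are real-valued smooth functions on $I$ and $a,c$ vanish nowhere on $I$; the gauged class consists of the equations with $a=1$, $b=0$, i.e. $$u_t=u_{xx}-c(t)u^3.\tag{2}$$ A Lie symmetry operator of an equation is a smooth vector field $X=\tau\partial_t+\xi\partial_x+\eta\partial_u$, with $\tau,\xi,\eta$ functions of $(t,x,u)$ on a box $I\times J\times U$ ($J,U\subseteq\mathbb R$ any nonempty open intervals), whose second prolongation annihilates $u_t-a^2u_{xx}-bu+cu^3$ at every second-order jet over the box that satisfies the equation. $A^{\max}$ denotes the set of all these operators. An equation has a Lie symmetry extension if $A^{\max}\neq\langle\partial_x\rangle$. Let $G^\sim$ be the group of transformations $\tilde t=\theta(t)$, $\tilde x=\delta_1x+\delta_2$, $\tilde u=\varphi(t)u$ with $\theta,\varphi$ smooth, $\theta_t\varphi\ne0$, $\delta_1\ne0$, which map (1) to the equation on $\theta(I)$ with coefficients given by $$\tilde a^2(\tilde t)=\frac{\delta_1^2}{\theta_t}a^2(t),\quad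 \tilde b(\tilde t)=\frac{\varphi b(t)+\varphi_t}{\varphi\,\theta_t},\quad \tilde c(\tilde t)=\frac{c(t)}{\varphi^2\theta_t},$$ and let $G_1^\sim$ be the group of transformations $\tilde t=\delta_1^2t+\delta_0$, $\tilde x=\delta_1x+\delta_2$, $\tilde u=\delta_3u$, $\tilde c(\tilde t)=c(t)/(\delta_1^2\delta_3^2)$ of the class (2), with constants $\delta_i$, $\delta_1\delta_3\neq0$. **(A) Gauged class.** The kernel (intersection over all $c$) of the algebras $A^{\max}$ of the equations (2) on $I$ is the one-dimensional algebra $\langle\partial_x\rangle$. Every equation (2) with a Lie symmetry extension is $G_1^\sim$-equivalent to one of the following, with $\varepsilon=\pm1$: 1. $c=\varepsilon|t|^\rho$ with $\rho\ne0$, on an interval not containing $0$; basis of $A^{\max}$: $\partial_x,\ 2t\partial_t+x\partial_x-(\rho+1)u\partial_u$; 2. $c=\varepsilon e^{\pm t}$; basis: $\partial_x,\ 2\partial_t\mp u\partial_u$; 3. $c=\varepsilon$; basis: $\partial_x,\ \partial_t,\ 2t\partial_t+x\partial_x-u\partial_u$. Conversely, on every admissible interval each of these equations belongs to the class (2), has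 a Lie symmetry extension, and $A^{\max}$ has the indicated basis. Two of these equations that differ in the case number, in $\varepsilon$, in $\rho$ or in the sign $\pm$ are neither $G_1^\sim$-equivalent nor $G^\sim$-equivalent, on whatever intervals they are considered. **(B) Original class.** For fixed $a,b$, the kernel (intersection over all $c$) of the algebras $A^{\max}$ of the equations (1) on $I$ is the one-dimensional algebra $\langle\partial_x\rangle$. Every equation (1) with a Lie symmetry extension is $G^\sim$-equivalent to an equation (2) from the list 1–3. Without gauging: let $T$ and $B$ be any antiderivatives on $I$ of $a^2$ and $b$. Equation (1) has a Lie symmetry extension if and only if $c$ has one of the following forms on $I$, and whenever $c$ has such a form, the indicated operators are a basis of $A^{\max}$: 1. $c=\mu a^2e^{-2B}|\gamma T+\delta|^\rho$ with constants $\mu\gamma\rho\neq0$ and $\delta$, where $\gamma T+\delta\ne0$ on $I$; basis: $\partial_x,\ \frac2{a^2}(\gamma T+\delta)\partial_t+\gamma x\partial_x+\bigl(\frac2{a^2}(\gamma T+\delta)b-(\rho+1)\gamma\bigr)u\partial_u$; 2. $c=\mu a^2e^{\sigma T-2B}$ with constants $\mu\sigma\ne0$; basis: $\partial_x,\ \frac2{a^2}\partial_t+\bigl(\frac{2b}{a^2}-\sigma\bigr)u\partial_u$;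 3. $c=\mu a^2e^{-2B}$ with a constant $\mu\neq0$; basis: $\partial_x,\ \frac1{a^2}(\partial_t+bu\partial_u),\ \frac{2T}{a^2}\partial_t+x\partial_x+\bigl(\frac{2Tb}{a^2}-1\bigr)u\partial_u$. -/

import Mathlib

open scoped ContDiff

noncomputable section

namespace NWS

/-- Nonempty open intervals of the real line (bounded or not). -/
def OpenInterval (s : Set ℝ) : Prop := IsOpen s ∧ IsConnected s

/-- The equation `u_t = a(t)² u_xx + b(t) u - c(t) u³` on the `t`-interval `I` belongs to the class:
the coefficients are smooth on `I`, and `a`, `c` vanish nowhere on `I`. -/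
structure InClass (I : Set ℝ) (a b c : ℝ → ℝ) : Prop where
  interval : OpenInterval I
  smooth_a : ContDiffOn ℝ ∞ a I
  smooth_b : ContDiffOn ℝ ∞ b I
  smooth_c : ContDiffOn ℝ ∞ c I
  a_ne : ∀ t ∈ I, a t ≠ 0
  c_ne : ∀ t ∈ I, c t ≠ 0

/-! Jet coordinates.  Points of the space of independent and dependent variables are
`(t, x, u) : Fin 3 → ℝ`; first-order jets are `(t, x, u, u_t, u_x) : Fin 5 → ℝ`; second-order jets
are `(t, x, u, u_t, u_x, u_tt, u_tx, u_xx) : Fin 8 → ℝ`. -/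

/-- The point `(t, x, u)` under a first-order jet. -/
def point (j : Fin 5 → ℝ) : Fin 3 → ℝ := ![j 0, j 1, j 2]

/-- The first-order jet under a second-order jet. -/
def jetOne (j : Fin 8 → ℝ) : Fin 5 → ℝ := ![j 0, j 1, j 2, j 3, j 4]

/-- Total derivative `D_t = ∂_t + u_t ∂_u` of a function of `(t, x, u)`. -/
def totalT (f : (Fin 3 → ℝ) → ℝ) (j : Fin 5 → ℝ) : ℝ :=
  fderiv ℝ f (point j) ![1, 0, j 3]

/-- Total derivative `D_x = ∂_x + u_x ∂_u` of a function of `(t, x, u)`. -/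
def totalX (f : (Fin 3 → ℝ) → ℝ) (j : Fin 5 → ℝ) : ℝ :=
  fderiv ℝ f (point j) ![0, 1, j 4]

/-- Total derivative `D_t = ∂_t + u_t ∂_u + u_tt ∂_{u_t} + u_tx ∂_{u_x}` of a function of
first-order jets. -/
def totalT' (F : (Fin 5 → ℝ) → ℝ) (j : Fin 8 → ℝ) : ℝ :=
  fderiv ℝ F (jetOne j) ![1, 0, j 3, j 5, j 6]

/-- Total derivative `D_x = ∂_x + u_x ∂_u + u_tx ∂_{u_t} + u_xx ∂_{u_x}` of a function of
first-order jets. -/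
def totalX' (F : (Fin 5 → ℝ) → ℝ) (j : Fin 8 → ℝ) : ℝ :=
  fderiv ℝ F (jetOne j) ![0, 1, j 4, j 6, j 7]

/-- Vector fields `X = τ ∂_t + ξ ∂_x + η ∂_u`, given by the components `(τ, ξ, η)`. -/
abbrev VectorField : Type := (Fin 3 → ℝ) → (Fin 3 → ℝ)

/-- The component `τ` of a vector field. -/
def tau (X : VectorField) (p : Fin 3 → ℝ) : ℝ := X p 0

/-- The component `ξ` of a vector field. -/
def xi (X : VectorField) (p : Fin 3 → ℝ) : ℝ := X p 1

/-- The component `η` of a vector field. -/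
def eta (X : VectorField) (p : Fin 3 → ℝ) : ℝ := X p 2

/-- `η^t = D_t η - u_t D_t τ - u_x D_t ξ`. -/
def etaT (X : VectorField) (j : Fin 5 → ℝ) : ℝ :=
  totalT (eta X) j - j 3 * totalT (tau X) j - j 4 * totalT (xi X) j

/-- `η^x = D_x η - u_t D_x τ - u_x D_x ξ`. -/
def etaX (X : VectorField) (j : Fin 5 → ℝ) : ℝ :=
  totalX (eta X) j - j 3 * totalX (tau X) j - j 4 * totalX (xi X) j

/-- `η^tt = D_t η^t - u_tt D_t τ - u_tx D_t ξ`. -/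
def etaTT (X : VectorField) (j : Fin 8 → ℝ) : ℝ :=
  totalT' (etaT X) j - j 5 * totalT (tau X) (jetOne j) - j 6 * totalT (xi X) (jetOne j)

/-- `η^tx = D_x η^t - u_tt D_x τ - u_tx D_x ξ`. -/
def etaTX (X : VectorField) (j : Fin 8 → ℝ) : ℝ :=
  totalX' (etaT X) j - j 5 * totalX (tau X) (jetOne j) - j 6 * totalX (xi X) (jetOne j)

/-- `η^xx = D_x η^x - u_tx D_x τ - u_xx D_x ξ`. -/
def etaXX (X : VectorField) (j : Fin 8 → ℝ) : ℝ :=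
  totalX' (etaX X) j - j 6 * totalX (tau X) (jetOne j) - j 7 * totalX (xi X) (jetOne j)

/-- The second prolongation of a vector field, a vector field on second-order jets. -/
def prolongation (X : VectorField) (j : Fin 8 → ℝ) : Fin 8 → ℝ :=
  ![tau X (point (jetOne j)), xi X (point (jetOne j)), eta X (point (jetOne j)),
    etaT X (jetOne j), etaX X (jetOne j), etaTT X j, etaTX X j, etaXX X j]

/-- The function `u_t - a(t)² u_xx - b(t) u + c(t) u³` on second-order jets. -/
def equation (a b c : ℝ → ℝ) (j : Fin 8 → ℝ) : ℝ :=
  j 3 - (a (j 0)) ^ 2 * j 7 - b (j 0) * j 2 + c (j 0) * (j 2) ^ 3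

/-- The box `t ∈ I`, `x ∈ J`, `u ∈ U`. -/
def box (I J U : Set ℝ) : Set (Fin 3 → ℝ) := {p | p 0 ∈ I ∧ p 1 ∈ J ∧ p 2 ∈ U}

/-- `X` is a (smooth) Lie symmetry operator of the equation with coefficients `a, b, c` over the
box: its second prolongation annihilates the equation at every second-order jet over the box that
satisfies the equation. -/
def IsLieSymmetry (I J U : Set ℝ) (a b c : ℝ → ℝ) (X : VectorField) : Prop :=
  ContDiffOn ℝ ∞ X (box I J U) ∧
  ∀ j : Fin 8 → ℝ, point (jetOne j) ∈ box I J U → equation a b c j = 0 →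
    fderiv ℝ (equation a b c) j (prolongation X j) = 0

/-- The maximal Lie symmetry algebra `A^max`: all Lie symmetry operators over the box, as functions
on the box. -/
def maxAlgebra (I J U : Set ℝ) (a b c : ℝ → ℝ) : Set (box I J U → (Fin 3 → ℝ)) :=
  {Y | ∃ X : VectorField, IsLieSymmetry I J U a b c X ∧ Y = (box I J U).domRestrict X}

/-- The real linear span of a list of vector fields, restricted to the box. -/
def spanOn (I J U : Set ℝ) (l : List VectorField) : Set (box I J U → (Fin 3 → ℝ)) :=
  Submodule.span ℝ (Set.range fun i : Fin l.length => (box I J U).domRestrict (l.get i))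

/-- The listed vector fields, restricted to the box, form a basis of `A`. -/
def IsBasisOn (I J U : Set ℝ) (l : List VectorField) (A : Set (box I J U → (Fin 3 → ℝ))) : Prop :=
  LinearIndependent ℝ (fun i : Fin l.length => (box I J U).domRestrict (l.get i)) ∧
    A = spanOn I J U l

/-- The vector field `∂_x`. -/
def dx : VectorField := fun _ => ![0, 1, 0]

/-- The equation has a Lie symmetry extension: `A^max ≠ ⟨∂_x⟩`. -/
def HasExtension (I J U : Set ℝ) (a b c : ℝ → ℝ) : Prop :=
  maxAlgebra I J U a b c ≠ spanOn I J U [dx]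

/-- Equivalence with respect to the group `G^∼` of the whole class, i.e. the transformations
`t̃ = θ(t)`, `x̃ = δ₁ x + δ₂`, `ũ = φ(t) u` acting on the coefficients.  (The translation
parameter `δ₂` acts trivially on the coefficients.) -/
def Equivalent (I : Set ℝ) (a b c : ℝ → ℝ) (I' : Set ℝ) (a' b' c' : ℝ → ℝ) : Prop :=
  ∃ (θ φ : ℝ → ℝ) (δ₁ : ℝ), ContDiffOn ℝ ∞ θ I ∧ ContDiffOn ℝ ∞ φ I ∧ δ₁ ≠ 0 ∧
    (∀ t ∈ I, deriv θ t ≠ 0 ∧ φ t ≠ 0) ∧ θ '' I = I' ∧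
    ∀ t ∈ I,
      (a' (θ t)) ^ 2 = δ₁ ^ 2 / deriv θ t * (a t) ^ 2 ∧
      b' (θ t) = (φ t * b t + deriv φ t) / (φ t * deriv θ t) ∧
      c' (θ t) = c t / ((φ t) ^ 2 * deriv θ t)

/-- Equivalence with respect to the group `G₁^∼` of the gauged class `u_t = u_xx - c(t) u³`, i.e.
the transformations `t̃ = δ₁² t + δ₀`, `x̃ = δ₁ x + δ₂`, `ũ = δ₃ u`. -/
def GaugedEquivalent (I : Set ℝ) (c : ℝ → ℝ) (I' : Set ℝ) (c' : ℝ → ℝ) : Prop :=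
  ∃ δ₀ δ₁ δ₃ : ℝ, δ₁ ≠ 0 ∧ δ₃ ≠ 0 ∧ (fun t => δ₁ ^ 2 * t + δ₀) '' I = I' ∧
    ∀ t ∈ I, c' (δ₁ ^ 2 * t + δ₀) = c t / (δ₁ ^ 2 * δ₃ ^ 2)

/-- The cases of the classification of the gauged class, with their parameters:
`c = ε |t|^ρ`, `c = ε e^{s t}` (with `s = ±1`), `c = ε`. -/
inductive GaugedCase : Type
  | power (ε ρ : ℝ)
  | exponential (ε s : ℝ)
  | constant (ε : ℝ)

/-- The restrictions on the parameters of a case over the `t`-interval `I`. -/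
def GaugedCase.Admissible (I : Set ℝ) : GaugedCase → Prop
  | .power ε ρ => (ε = 1 ∨ ε = -1) ∧ ρ ≠ 0 ∧ ∀ t ∈ I, t ≠ 0
  | .exponential ε s => (ε = 1 ∨ ε = -1) ∧ (s = 1 ∨ s = -1)
  | .constant ε => ε = 1 ∨ ε = -1

/-- The coefficient `c(t)`. -/
def GaugedCase.coeff : GaugedCase → ℝ → ℝ
  | .power ε ρ => fun t => ε * |t| ^ ρ
  | .exponential ε s => fun t => ε * Real.exp (s * t)
  | .constant ε => fun _ => ε

/-- The listed basis of `A^max`. -/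
def GaugedCase.basis : GaugedCase → List VectorField
  | .power _ ρ => [dx, fun p => ![2 * p 0, p 1, -(ρ + 1) * p 2]]
  | .exponential _ s => [dx, fun p => ![2, 0, -s * p 2]]
  | .constant _ => [dx, fun _ => ![1, 0, 0], fun p => ![2 * p 0, p 1, -p 2]]

/-- The cases of the classification of the whole class without gauging, with their parameters. -/
inductive FullCase : Type
  | power (μ γ δ ρ : ℝ)
  | exponential (μ σ : ℝ)
  | constant (μ : ℝ)

/-- The restrictions on the parameters of a case over the `t`-interval `I`; here `T = ∫ a² dt`. -/
def FullCase.Admissible (I : Set ℝ) (T : ℝ → ℝ) : FullCase → Prop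
  | .power μ γ δ ρ => μ ≠ 0 ∧ γ ≠ 0 ∧ ρ ≠ 0 ∧ ∀ t ∈ I, γ * T t + δ ≠ 0
  | .exponential μ σ => μ ≠ 0 ∧ σ ≠ 0
  | .constant μ => μ ≠ 0

/-- The coefficient `c(t)`; here `T = ∫ a² dt` and `B = ∫ b dt`. -/
def FullCase.coeff (a T B : ℝ → ℝ) : FullCase → ℝ → ℝ
  | .power μ γ δ ρ => fun t =>
      μ * (a t) ^ 2 * Real.exp (-2 * B t) * |γ * T t + δ| ^ ρ
  | .exponential μ σ => fun t => μ * (a t) ^ 2 * Real.exp (σ * T t - 2 * B t)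
  | .constant μ => fun t => μ * (a t) ^ 2 * Real.exp (-2 * B t)

/-- The listed basis of `A^max`; here `T = ∫ a² dt`. -/
def FullCase.basis (a b T : ℝ → ℝ) : FullCase → List VectorField
  | .power _ γ δ ρ =>
      [dx, fun p =>
        ![2 / (a (p 0)) ^ 2 * (γ * T (p 0) + δ), γ * p 1,
          (2 / (a (p 0)) ^ 2 * (γ * T (p 0) + δ) * b (p 0) - (ρ + 1) * γ) * p 2]]
  | .exponential _ σ =>
      [dx, fun p => ![2 / (a (p 0)) ^ 2, 0, (2 * b (p 0) / (a (p 0)) ^ 2 - σ) * p 2]]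
  | .constant _ =>
      [dx, fun p => ![1 / (a (p 0)) ^ 2, 0, b (p 0) / (a (p 0)) ^ 2 * p 2],
        fun p => ![2 * T (p 0) / (a (p 0)) ^ 2, p 1,
          (2 * T (p 0) * b (p 0) / (a (p 0)) ^ 2 - 1) * p 2]]

end NWS

end

noncomputable section

namespace NWS

/-! Once `u_t` is eliminated by means of the equation, the invariance criterion is polynomial in the
free jet variables `u_x`, `u_tx`, `u_xx`. Its coefficients say that `τ` depends on `t` only, `ξ`
does not involve `u`, and `η = H₀ + u H₁` is affine in `u` (`determining_equations`). What remains
is a cubic in `u`. As `c` has no zeros, its `u²` coefficient kills `H₀`, and its `u³` coefficient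
expresses `H₁` through `t` alone. This makes `ξ` affine in `x` and independent of `t`, and
everything integrates: with `T' = a²`, `ξ = kx + l`, `a²τ = 2kT + n`, `H₁ = bτ + m`
(`IsLieSymmetry.eq_field`).

Only the `u³` coefficient survives as a condition. Taking `T` as the time and `e^{-B} u` as the
unknown, with `B' = b`, turns the equation into a gauged one with coefficient `h`, where `c = a²
e^{-2B} h`; in terms of `h` the condition is `h'(2kT + n) + 2(k + m)T'h = 0`, and conversely every
quadruple `(k, l, m, n)` that satisfies it gives a symmetry (`maxAlgebra_eq`). The parameter `l` is
free and yields `∂_x`. If `k = n = 0` then `m = 0`, so an extension exists exactly when some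
solution has `(k, n) ≠ (0, 0)`. For such a solution the condition is a first-order linear equation
for `h`, solved by a power of an affine function of `T`, an exponential of `T`, or a constant
(`classify_multiplier`). For each of these `h` the condition becomes linear in `(k, m, n)`, which
gives the bases (`FullCase.isBasisOn`). In the kernel, the two choices `h = 1` and `h = e^T` already
leave only `∂_x`.

The normal forms arise by a shift and a scaling of `T` and `u`. Between gauged equations `G^∼`
reduces to `G₁^∼`, under which the sign of `c` is invariant and the logarithmic derivative of `c`
transforms simply; these two quantities separate the listed cases. -/

/-! ### The second prolongation in coordinates. -/

/-- Product rule for the pairing of `Df` with the direction `(0, 1, u_x)`, both of which depend on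
the jet: the first term differentiates `Df`, the second the direction. -/
theorem hasFDerivAt_totalX {f : (Fin 3 → ℝ) → ℝ} {j : Fin 5 → ℝ}
    (hf : DifferentiableAt ℝ (fderiv ℝ f) (point j)) (v : Fin 5 → ℝ) :
    DifferentiableAt ℝ (totalX f) j ∧ fderiv ℝ (totalX f) j v =
      fderiv ℝ (fderiv ℝ f) (point j) (point v) ![0, 1, j 4] +
        fderiv ℝ f (point j) ![0, 0, v 4] := by
  obtain ⟨L, hL⟩ : ∃ L : (Fin 5 → ℝ) →L[ℝ] (Fin 3 → ℝ), ∀ x, L x = point x :=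
    ⟨ContinuousLinearMap.pi
      ![ContinuousLinearMap.proj 0, ContinuousLinearMap.proj 1, ContinuousLinearMap.proj 2],
      fun x => by ext i; fin_cases i <;> simp [point]⟩
  obtain ⟨M, hM⟩ : ∃ M : (Fin 5 → ℝ) →L[ℝ] (Fin 3 → ℝ), ∀ x, M x = ![0, 0, x 4] :=
    ⟨ContinuousLinearMap.pi ![0, 0, ContinuousLinearMap.proj 4],
      fun x => by ext i; fin_cases i <;> simp⟩
  have hpt : HasFDerivAt point L j := by
    rw [show point = L from funext fun x => (hL x).symm]
    exact L.hasFDerivAt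
  have hw : HasFDerivAt (fun j : Fin 5 → ℝ => (![0, 1, j 4] : Fin 3 → ℝ)) M j := by
    have : (fun j : Fin 5 → ℝ => (![0, 1, j 4] : Fin 3 → ℝ)) = fun j => ![0, 1, 0] + M j := by
      funext x; rw [hM]; ext i; fin_cases i <;> simp
    rw [this]
    exact M.hasFDerivAt.const_add _
  have h := (HasFDerivAt.comp j hf.hasFDerivAt hpt).clm_apply hw
  refine ⟨h.differentiableAt, ?_⟩
  have h' : fderiv ℝ (totalX f) j = _ := h.fderiv
  rw [h']
  simp [add_comm, hL, hM]

/-- The factors 2 have two sources: `D_x` hitting the explicit `u_t`, `u_x` in `η^x`, and the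
correction terms in the definition of `η^xx`. -/
theorem etaXX_eq {X : VectorField} {j : Fin 8 → ℝ}
    (hX : ContDiffAt ℝ ∞ X (point (jetOne j))) :
    etaXX X j =
      fderiv ℝ (fderiv ℝ (eta X)) (point (jetOne j)) ![0, 1, j 4] ![0, 1, j 4]
        + fderiv ℝ (eta X) (point (jetOne j)) ![0, 0, j 7]
      - j 3 * (fderiv ℝ (fderiv ℝ (tau X)) (point (jetOne j)) ![0, 1, j 4] ![0, 1, j 4]
        + fderiv ℝ (tau X) (point (jetOne j)) ![0, 0, j 7])
      - j 4 * (fderiv ℝ (fderiv ℝ (xi X)) (point (jetOne j)) ![0, 1, j 4] ![0, 1, j 4]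
        + fderiv ℝ (xi X) (point (jetOne j)) ![0, 0, j 7])
      - 2 * j 6 * fderiv ℝ (tau X) (point (jetOne j)) ![0, 1, j 4]
      - 2 * j 7 * fderiv ℝ (xi X) (point (jetOne j)) ![0, 1, j 4] := by
  have hc : ∀ i, DifferentiableAt ℝ (fderiv ℝ (fun p => X p i)) (point (jetOne j)) := fun i =>
    (((contDiffAt_pi.1 hX i).fderiv_right (m := 1) (by norm_cast))).differentiableAt (by norm_num)
  set v : Fin 5 → ℝ := ![0, 1, j 4, j 6, j 7] with hv
  obtain ⟨d0, e0⟩ := hasFDerivAt_totalX (f := tau X) (hc 0) v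
  obtain ⟨d1, e1⟩ := hasFDerivAt_totalX (f := xi X) (hc 1) v
  obtain ⟨d2, e2⟩ := hasFDerivAt_totalX (f := eta X) (hc 2) v
  have h3 := hasFDerivAt_apply (𝕜 := ℝ) (F' := fun _ : Fin 5 => ℝ) (3 : Fin 5) (jetOne j)
  have h4 := hasFDerivAt_apply (𝕜 := ℝ) (F' := fun _ : Fin 5 => ℝ) (4 : Fin 5) (jetOne j)
  have h := ((d2.hasFDerivAt.sub (h3.mul d0.hasFDerivAt)).sub (h4.mul d1.hasFDerivAt)).fderiv
  have hE : fderiv ℝ (etaX X) (jetOne j) = _ := h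
  unfold etaXX totalX'
  rw [hE]
  have pv : point v = ![0, 1, j 4] := by simp [point, hv]
  rw [pv] at e0 e1 e2
  simp only [sub_apply, add_apply,
    smul_apply, e0, e1, e2, ← hv, smul_eq_mul, ContinuousLinearMap.proj_apply]
  simp only [totalX, jetOne, hv]
  simp
  ring

/-- Partial derivatives in coordinates. -/
def pd (i : Fin 3) (f : (Fin 3 → ℝ) → ℝ) (p : Fin 3 → ℝ) : ℝ := fderiv ℝ f p (Pi.single i 1)

theorem fderiv_vec (f : (Fin 3 → ℝ) → ℝ) (p : Fin 3 → ℝ) (r s y : ℝ) :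
    fderiv ℝ f p ![r, s, y] = r * pd 0 f p + s * pd 1 f p + y * pd 2 f p := by
  have : (![r, s, y] : Fin 3 → ℝ) =
      r • Pi.single 0 1 + s • Pi.single 1 1 + y • Pi.single 2 1 := by
    ext i; fin_cases i <;> simp
  rw [this]; simp [pd]

theorem fderiv_pd {f : (Fin 3 → ℝ) → ℝ} {p : Fin 3 → ℝ}
    (hf : DifferentiableAt ℝ (fderiv ℝ f) p) (i k : Fin 3) :
    pd i (pd k f) p = fderiv ℝ (fderiv ℝ f) p (Pi.single i 1) (Pi.single k 1) := by
  have h := (hf.hasFDerivAt.clm_apply (hasFDerivAt_const (Pi.single k (1 : ℝ)) p)).fderiv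
  have h' : fderiv ℝ (pd k f) p = _ := h
  unfold pd at h' ⊢
  rw [h']; simp

/-- Symmetry of the second derivative merges the two mixed terms. -/
theorem fderiv_fderiv_vec {f : (Fin 3 → ℝ) → ℝ} {p : Fin 3 → ℝ}
    (hf : ContDiffAt ℝ ∞ f p) (y : ℝ) :
    fderiv ℝ (fderiv ℝ f) p ![0, 1, y] ![0, 1, y] =
      pd 1 (pd 1 f) p + 2 * y * pd 1 (pd 2 f) p + y ^ 2 * pd 2 (pd 2 f) p := by
  have hd : DifferentiableAt ℝ (fderiv ℝ f) p :=
    ((hf.fderiv_right (m := 1) (by norm_cast))).differentiableAt (by norm_num)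
  have hs : IsSymmSndFDerivAt ℝ f p := hf.isSymmSndFDerivAt (by simp; exact WithTop.coe_le_coe.2 (le_top : (2 : ℕ∞) ≤ ⊤))
  have : (![0, 1, y] : Fin 3 → ℝ) = Pi.single 1 1 + y • Pi.single 2 1 := by
    ext i; fin_cases i <;> simp
  have hs' := hs (Pi.single 1 1) (Pi.single 2 1)
  rw [this, fderiv_pd hd, fderiv_pd hd, fderiv_pd hd]
  simp only [map_add, map_smul, add_apply, smul_apply,
    smul_eq_mul]
  rw [hs']
  ring

theorem fderiv_equation {a b c : ℝ → ℝ} {j : Fin 8 → ℝ} (ha : DifferentiableAt ℝ a (j 0))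
    (hb : DifferentiableAt ℝ b (j 0)) (hc : DifferentiableAt ℝ c (j 0)) (v : Fin 8 → ℝ) :
    fderiv ℝ (equation a b c) j v =
      v 3 - (2 * a (j 0) * deriv a (j 0) * v 0 * j 7 + a (j 0) ^ 2 * v 7)
      - (deriv b (j 0) * v 0 * j 2 + b (j 0) * v 2)
      + (deriv c (j 0) * v 0 * j 2 ^ 3 + c (j 0) * (3 * j 2 ^ 2 * v 2)) := by
  have P := fun i => hasFDerivAt_apply (𝕜 := ℝ) (F' := fun _ : Fin 8 => ℝ) i j
  have A := ha.hasDerivAt.comp_hasFDerivAt j (P 0)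
  have B := hb.hasDerivAt.comp_hasFDerivAt j (P 0)
  have C := hc.hasDerivAt.comp_hasFDerivAt j (P 0)
  have h := ((((P 3).sub ((A.pow 2).mul (P 7))).sub (B.mul (P 2))).add
    (C.mul ((P 2).pow 3))).fderiv
  have h' : fderiv ℝ (equation a b c) j = _ := h
  rw [h']
  simp
  ring

/-- The infinitesimal invariance criterion, written out in jet coordinates. -/
def invariance (a b c : ℝ → ℝ) (X : VectorField) (p : Fin 3 → ℝ) (ut ux utx uxx : ℝ) : ℝ :=
  pd 0 (eta X) p + ut * pd 2 (eta X) p - ut * (pd 0 (tau X) p + ut * pd 2 (tau X) p)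
    - ux * (pd 0 (xi X) p + ut * pd 2 (xi X) p)
  - a (p 0) ^ 2 *
    (pd 1 (pd 1 (eta X)) p + 2 * ux * pd 1 (pd 2 (eta X)) p + ux ^ 2 * pd 2 (pd 2 (eta X)) p
        + uxx * pd 2 (eta X) p
      - ut * (pd 1 (pd 1 (tau X)) p + 2 * ux * pd 1 (pd 2 (tau X)) p
        + ux ^ 2 * pd 2 (pd 2 (tau X)) p + uxx * pd 2 (tau X) p)
      - ux * (pd 1 (pd 1 (xi X)) p + 2 * ux * pd 1 (pd 2 (xi X)) p
        + ux ^ 2 * pd 2 (pd 2 (xi X)) p + uxx * pd 2 (xi X) p)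
      - 2 * utx * (pd 1 (tau X) p + ux * pd 2 (tau X) p)
      - 2 * uxx * (pd 1 (xi X) p + ux * pd 2 (xi X) p))
  - 2 * a (p 0) * deriv a (p 0) * tau X p * uxx
  - deriv b (p 0) * tau X p * p 2 - b (p 0) * eta X p
  + deriv c (p 0) * tau X p * p 2 ^ 3 + 3 * c (p 0) * p 2 ^ 2 * eta X p

theorem fderiv_equation_prolongation {a b c : ℝ → ℝ} {X : VectorField} {j : Fin 8 → ℝ}
    (ha : DifferentiableAt ℝ a (j 0)) (hb : DifferentiableAt ℝ b (j 0))
    (hc : DifferentiableAt ℝ c (j 0)) (hX : ContDiffAt ℝ ∞ X (point (jetOne j))) :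
    fderiv ℝ (equation a b c) j (prolongation X j) =
      invariance a b c X (point (jetOne j)) (j 3) (j 4) (j 6) (j 7) := by
  have h0 := fun y => fderiv_fderiv_vec (f := tau X) (contDiffAt_pi.1 hX 0) y
  have h1 := fun y => fderiv_fderiv_vec (f := xi X) (contDiffAt_pi.1 hX 1) y
  have h2 := fun y => fderiv_fderiv_vec (f := eta X) (contDiffAt_pi.1 hX 2) y
  rw [fderiv_equation ha hb hc]
  have e3 : prolongation X j 3 = etaT X (jetOne j) := rfl
  have e7 : prolongation X j 7 = etaXX X j := rfl
  have e0 : prolongation X j 0 = tau X (point (jetOne j)) := rfl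
  have e2 : prolongation X j 2 = eta X (point (jetOne j)) := rfl
  rw [e3, e7, e0, e2, etaXX_eq hX, h0, h1, h2]
  simp only [etaT, totalT, fderiv_vec, invariance]
  have q0 : point (jetOne j) 0 = j 0 := rfl
  have q2 : point (jetOne j) 2 = j 2 := rfl
  have q3 : jetOne j 3 = j 3 := rfl
  have q4 : jetOne j 4 = j 4 := rfl
  rw [q0, q2, q3, q4]
  ring

/-! ### The invariance criterion over a box. -/

theorem isOpen_box {I J U : Set ℝ} (hI : IsOpen I) (hJ : IsOpen J) (hU : IsOpen U) :
    IsOpen (box I J U) :=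
  (hI.preimage (continuous_apply 0)).inter
    ((hJ.preimage (continuous_apply 1)).inter (hU.preimage (continuous_apply 2)))

theorem InClass.differentiableAt {I : Set ℝ} {a b c : ℝ → ℝ} (h : InClass I a b c) {t : ℝ}
    (ht : t ∈ I) : DifferentiableAt ℝ a t ∧ DifferentiableAt ℝ b t ∧ DifferentiableAt ℝ c t :=
  have hn := h.interval.1.mem_nhds ht
  ⟨(h.smooth_a.contDiffAt hn).differentiableAt (by simp),
    (h.smooth_b.contDiffAt hn).differentiableAt (by simp),
    (h.smooth_c.contDiffAt hn).differentiableAt (by simp)⟩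

/-- The equation is solved for `u_t`, and `u_tt` does not enter the criterion (it is set to 0
below), so `u_x`, `u_tx`, `u_xx` are free coordinates on the jets that satisfy the equation. -/
theorem isLieSymmetry_iff {I J U : Set ℝ} {a b c : ℝ → ℝ} (h : InClass I a b c)
    (hJ : IsOpen J) (hU : IsOpen U) (X : VectorField) :
    IsLieSymmetry I J U a b c X ↔ ContDiffOn ℝ ∞ X (box I J U) ∧
      ∀ p ∈ box I J U, ∀ ux utx uxx : ℝ, invariance a b c X p
        (a (p 0) ^ 2 * uxx + b (p 0) * p 2 - c (p 0) * p 2 ^ 3) ux utx uxx = 0 := by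
  have ho := isOpen_box h.interval.1 hJ hU
  refine and_congr_right fun hX => ⟨fun H p hp ux utx uxx => ?_, fun H j hj he => ?_⟩
  · set j : Fin 8 → ℝ := ![p 0, p 1, p 2,
      a (p 0) ^ 2 * uxx + b (p 0) * p 2 - c (p 0) * p 2 ^ 3, ux, 0, utx, uxx] with hjdef
    have hpj : point (jetOne j) = p := by
      ext i; fin_cases i <;> simp [point, jetOne, hjdef]
    have hd := h.differentiableAt (t := j 0) hp.1
    have := H j (hpj ▸ hp) (by simp [equation, hjdef]; ring)
    rw [fderiv_equation_prolongation hd.1 hd.2.1 hd.2.2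
      (hX.contDiffAt (ho.mem_nhds (hpj ▸ hp))), hpj] at this
    exact this
  · have hd := h.differentiableAt (t := j 0) hj.1
    rw [fderiv_equation_prolongation hd.1 hd.2.1 hd.2.2 (hX.contDiffAt (ho.mem_nhds hj))]
    have := H _ hj (j 4) (j 6) (j 7)
    have e : j 3 = a (j 0) ^ 2 * j 7 + b (j 0) * j 2 - c (j 0) * j 2 ^ 3 := by
      unfold equation at he; linarith
    rw [e]; exact this

/-! ### Constancy and polynomial splitting on open intervals. -/

theorem OpenInterval.eq_of_hasDerivAt_zero {I : Set ℝ} (hI : OpenInterval I) {f : ℝ → ℝ}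
    (hf : ∀ t ∈ I, HasDerivAt f 0 t) {s t : ℝ} (hs : s ∈ I) (ht : t ∈ I) : f s = f t :=
  hI.1.is_const_of_deriv_eq_zero hI.2.isPreconnected
    (fun t ht => (hf t ht).differentiableAt.differentiableWithinAt) (fun t ht => (hf t ht).deriv)
    hs ht

theorem OpenInterval.infinite {I : Set ℝ} (hI : OpenInterval I) : I.Infinite := by
  obtain ⟨t, ht⟩ := hI.2.nonempty
  exact infinite_of_mem_nhds t (hI.1.mem_nhds ht)

theorem OpenInterval.exists_ne {I : Set ℝ} (hI : OpenInterval I) (s : ℝ) : ∃ t ∈ I, t ≠ s := by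
  obtain ⟨t, ht, hs⟩ := hI.infinite.exists_notMem_finset {s}
  exact ⟨t, ht, by simpa using hs⟩

theorem OpenInterval.cubic_eq_zero {U : Set ℝ} (hU : OpenInterval U) {d₀ d₁ d₂ d₃ : ℝ}
    (h : ∀ u ∈ U, d₃ * u ^ 3 + d₂ * u ^ 2 + d₁ * u + d₀ = 0) :
    d₃ = 0 ∧ d₂ = 0 ∧ d₁ = 0 ∧ d₀ = 0 := by
  open Polynomial in
  have hp : (C d₃ * X ^ 3 + C d₂ * X ^ 2 + C d₁ * X + C d₀ : ℝ[X]) = 0 :=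
    eq_zero_of_infinite_isRoot _ (hU.infinite.mono fun u hu => by simpa [IsRoot] using h u hu)
  refine ⟨?_, ?_, ?_, ?_⟩
  · simpa [Polynomial.coeff_X, Polynomial.coeff_C, Polynomial.coeff_X_pow] using
      congrArg (fun q => Polynomial.coeff q 3) hp
  · simpa [Polynomial.coeff_X, Polynomial.coeff_C, Polynomial.coeff_X_pow] using
      congrArg (fun q => Polynomial.coeff q 2) hp
  · simpa [Polynomial.coeff_X, Polynomial.coeff_C, Polynomial.coeff_X_pow] using
      congrArg (fun q => Polynomial.coeff q 1) hp
  · simpa [Polynomial.coeff_X, Polynomial.coeff_C, Polynomial.coeff_X_pow] using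
      congrArg (fun q => Polynomial.coeff q 0) hp

theorem vec_eta (p : Fin 3 → ℝ) : ![p 0, p 1, p 2] = p := by
  ext i; fin_cases i <;> rfl

theorem mem_box {I J U : Set ℝ} {t x u : ℝ} (ht : t ∈ I) (hx : x ∈ J) (hu : u ∈ U) :
    ![t, x, u] ∈ box I J U := ⟨ht, hx, hu⟩

theorem hasDerivAt_pd {f : (Fin 3 → ℝ) → ℝ} {γ : ℝ → Fin 3 → ℝ} {s : ℝ} (i : Fin 3)
    (hγ : HasDerivAt γ (Pi.single i 1) s) (hf : DifferentiableAt ℝ f (γ s)) :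
    HasDerivAt (fun r => f (γ r)) (pd i f (γ s)) s :=
  hf.hasFDerivAt.comp_hasDerivAt s hγ

/-! ### Determining equations and their integration. -/

section Partial

variable {I J U : Set ℝ} {f g : (Fin 3 → ℝ) → ℝ}

theorem hasDerivAt_pd_zero {t x u : ℝ} (hf : DifferentiableAt ℝ f ![t, x, u]) :
    HasDerivAt (fun s => f ![s, x, u]) (pd 0 f ![t, x, u]) t :=
  hasDerivAt_pd (γ := fun s => ![s, x, u]) 0 (hasDerivAt_pi.2 fun i => by
    fin_cases i
    · exact hasDerivAt_id t
    · exact hasDerivAt_const t x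
    · exact hasDerivAt_const t u) hf

theorem hasDerivAt_pd_one {t x u : ℝ} (hf : DifferentiableAt ℝ f ![t, x, u]) :
    HasDerivAt (fun s => f ![t, s, u]) (pd 1 f ![t, x, u]) x :=
  hasDerivAt_pd (γ := fun s => ![t, s, u]) 1 (hasDerivAt_pi.2 fun i => by
    fin_cases i
    · exact hasDerivAt_const x t
    · exact hasDerivAt_id x
    · exact hasDerivAt_const x u) hf

theorem hasDerivAt_pd_two {t x u : ℝ} (hf : DifferentiableAt ℝ f ![t, x, u]) :
    HasDerivAt (fun s => f ![t, x, s]) (pd 2 f ![t, x, u]) u :=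
  hasDerivAt_pd (γ := fun s => ![t, x, s]) 2 (hasDerivAt_pi.2 fun i => by
    fin_cases i
    · exact hasDerivAt_const u t
    · exact hasDerivAt_const u x
    · exact hasDerivAt_id u) hf

theorem pd_congr {s : Set (Fin 3 → ℝ)} (hs : IsOpen s) (h : ∀ p ∈ s, f p = g p) (i : Fin 3) :
    ∀ p ∈ s, pd i f p = pd i g p := fun p hp => by
  unfold pd
  rw [(Filter.eventuallyEq_of_mem (hs.mem_nhds hp) h).fderiv_eq]

theorem pd_eq_zero {s : Set (Fin 3 → ℝ)} (hs : IsOpen s) (h : ∀ p ∈ s, f p = 0) (i : Fin 3) :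
    ∀ p ∈ s, pd i f p = 0 := fun p hp => by
  rw [pd_congr (g := fun _ => 0) hs h i p hp]
  simp [pd]

theorem contDiffOn_pd {s : Set (Fin 3 → ℝ)} (hs : IsOpen s) (hf : ContDiffOn ℝ ∞ f s)
    (i : Fin 3) : ContDiffOn ℝ ∞ (pd i f) s :=
  (hf.fderiv_of_isOpen hs (m := ∞) (by simp)).clm_apply contDiffOn_const

theorem differentiableAt_of_contDiffOn {s : Set (Fin 3 → ℝ)} (hs : IsOpen s)
    (hf : ContDiffOn ℝ ∞ f s) : ∀ p ∈ s, DifferentiableAt ℝ f p := fun _ hp =>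
  (hf.contDiffAt (hs.mem_nhds hp)).differentiableAt (by simp)

/-- The determining equations of the Lie symmetry operators. -/
theorem determining_equations {a b c : ℝ → ℝ} (h : InClass I a b c)
    (hJ : OpenInterval J) (hU : OpenInterval U) {X : VectorField}
    (hX : IsLieSymmetry I J U a b c X) :
    ∀ p ∈ box I J U, pd 1 (tau X) p = 0 ∧ pd 2 (tau X) p = 0 ∧ pd 2 (xi X) p = 0 ∧
      pd 2 (pd 2 (eta X)) p = 0 ∧
      2 * a (p 0) ^ 2 * pd 1 (xi X) p =
        a (p 0) ^ 2 * pd 0 (tau X) p + 2 * a (p 0) * deriv a (p 0) * tau X p ∧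
      pd 0 (xi X) p + 2 * a (p 0) ^ 2 * pd 1 (pd 2 (eta X)) p =
        a (p 0) ^ 2 * pd 1 (pd 1 (xi X)) p ∧
      pd 0 (eta X) p
        + (b (p 0) * p 2 - c (p 0) * p 2 ^ 3) * (pd 2 (eta X) p - pd 0 (tau X) p)
        - a (p 0) ^ 2 * pd 1 (pd 1 (eta X)) p - deriv b (p 0) * tau X p * p 2
        - b (p 0) * eta X p + deriv c (p 0) * tau X p * p 2 ^ 3
        + 3 * c (p 0) * p 2 ^ 2 * eta X p = 0 := by
  have ho := isOpen_box h.interval.1 hJ.1 hU.1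
  obtain ⟨-, H⟩ := (isLieSymmetry_iff h hJ.1 hU.1 X).1 hX
  have ha : ∀ p ∈ box I J U, a (p 0) ^ 2 ≠ 0 := fun p hp => pow_ne_zero 2 (h.a_ne _ hp.1)
  -- The coefficient of `u_tx` is `2a²(τ_x + u_x τ_u)`; `u_x = 0` and then `u_x = 1` give the two
  -- equations for `τ`.
  have t1 : ∀ p ∈ box I J U, pd 1 (tau X) p = 0 := fun p hp => by
    have h1 := H p hp 0 1 0
    have h2 := H p hp 0 0 0
    refine (mul_eq_zero.1 ?_).resolve_left (ha p hp)
    unfold invariance at h1 h2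
    linear_combination (h1 - h2) / 2
  have t2 : ∀ p ∈ box I J U, pd 2 (tau X) p = 0 := fun p hp => by
    have h1 := H p hp 1 1 0
    have h2 := H p hp 1 0 0
    refine (mul_eq_zero.1 ?_).resolve_left (ha p hp)
    unfold invariance at h1 h2
    linear_combination (h1 - h2) / 2 - a (p 0) ^ 2 * t1 p hp
  have t11 := pd_eq_zero ho t1 1
  have t12 := pd_eq_zero ho t2 1
  have t22 := pd_eq_zero ho t2 2
  unfold invariance at H
  -- The mixed second difference in `u_x`, `u_xx` isolates the coefficient of `u_x u_xx`, now equal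
  -- to `2a²ξ_u`; part of it comes from the eliminated `u_t`.
  have x2 : ∀ p ∈ box I J U, pd 2 (xi X) p = 0 := fun p hp => by
    have h1 := H p hp 1 0 1
    have h2 := H p hp 1 0 0
    have h3 := H p hp 0 0 1
    have h4 := H p hp 0 0 0
    refine (mul_eq_zero.1 ?_).resolve_left (ha p hp)
    rw [t1 p hp, t2 p hp, t11 p hp, t12 p hp, t22 p hp] at h1 h2 h3 h4
    linear_combination (h1 - h2 - h3 + h4) / 2
  have x12 := pd_eq_zero ho x2 1
  have x22 := pd_eq_zero ho x2 2
  intro p hp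
  have K := fun y w => H p hp y 0 w
  rw [t1 p hp, t2 p hp, t11 p hp, t12 p hp, t22 p hp, x2 p hp, x12 p hp, x22 p hp] at K
  -- The remaining polynomial is split into its `u_x²` coefficient, its `u_xx` coefficient, its odd
  -- part in `u_x` and its constant term.
  refine ⟨t1 p hp, t2 p hp, x2 p hp, ?_, ?_, ?_, ?_⟩
  · refine (mul_eq_zero.1 ?_).resolve_left (ha p hp)
    linear_combination -(K 1 0 + K (-1) 0 - 2 * K 0 0) / 2
  · linear_combination K 0 1 - K 0 0
  · linear_combination -(K 1 0 - K (-1) 0) / 2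
  · linear_combination K 0 0

theorem pd_zero_eq_of_eq (hI : IsOpen I) {x x' u u' : ℝ}
    (hf : ∀ t ∈ I, DifferentiableAt ℝ f ![t, x, u])
    (hf' : ∀ t ∈ I, DifferentiableAt ℝ f ![t, x', u'])
    (h : ∀ t ∈ I, f ![t, x, u] = f ![t, x', u']) :
    ∀ t ∈ I, pd 0 f ![t, x, u] = pd 0 f ![t, x', u'] := fun t ht =>
  (hasDerivAt_pd_zero (hf t ht)).unique
    ((hasDerivAt_pd_zero (hf' t ht)).congr_of_eventuallyEq
      (Filter.eventuallyEq_of_mem (hI.mem_nhds ht) h))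

theorem pd_one_eq_of_eq (hJ : IsOpen J) {t t' u u' : ℝ}
    (hf : ∀ x ∈ J, DifferentiableAt ℝ f ![t, x, u])
    (hf' : ∀ x ∈ J, DifferentiableAt ℝ f ![t', x, u'])
    (h : ∀ x ∈ J, f ![t, x, u] = f ![t', x, u']) :
    ∀ x ∈ J, pd 1 f ![t, x, u] = pd 1 f ![t', x, u'] := fun x hx =>
  (hasDerivAt_pd_one (hf x hx)).unique
    ((hasDerivAt_pd_one (hf' x hx)).congr_of_eventuallyEq
      (Filter.eventuallyEq_of_mem (hJ.mem_nhds hx) h))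

/-- The vector field `τ = (2kT + n) / a²`, `ξ = kx + l`, `η = (bτ + m)u`. -/
def field (a b T : ℝ → ℝ) (k l m n : ℝ) : VectorField := fun p =>
  ![(2 * k * T (p 0) + n) / a (p 0) ^ 2, k * p 1 + l,
    (b (p 0) * ((2 * k * T (p 0) + n) / a (p 0) ^ 2) + m) * p 2]

/-- The determining equations are integrated on the box, one variable at a time. The final condition
on `c` is the `u³` coefficient multiplied by `a³`. -/
theorem IsLieSymmetry.eq_field {a b c T : ℝ → ℝ} (h : InClass I a b c)
    (hJ : OpenInterval J) (hU : OpenInterval U) (hT : ∀ t ∈ I, HasDerivAt T (a t ^ 2) t)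
    {X : VectorField} (hX : IsLieSymmetry I J U a b c X) :
    ∃ k l m n : ℝ, (∀ p ∈ box I J U, X p = field a b T k l m n p) ∧
      ∀ t ∈ I, deriv c t * a t * (2 * k * T t + n)
        + 2 * c t * (k * a t ^ 3 - deriv a t * (2 * k * T t + n))
        + 2 * c t * (b t * a t * (2 * k * T t + n) + m * a t ^ 3) = 0 := by
  have hI := h.interval
  have ho := isOpen_box hI.1 hJ.1 hU.1
  have D := determining_equations h hJ hU hX
  have sm := fun i => contDiffOn_pi.1 hX.1 i
  have sτ : ContDiffOn ℝ ∞ (tau X) (box I J U) := sm 0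
  have sξ : ContDiffOn ℝ ∞ (xi X) (box I J U) := sm 1
  have sη : ContDiffOn ℝ ∞ (eta X) (box I J U) := sm 2
  have dτ := differentiableAt_of_contDiffOn ho sτ
  have dξ := differentiableAt_of_contDiffOn ho sξ
  have dη := differentiableAt_of_contDiffOn ho sη
  have dξ1 := differentiableAt_of_contDiffOn ho (contDiffOn_pd ho sξ 1)
  set H₁ := pd 2 (eta X) with hH₁
  have sH₁ := contDiffOn_pd ho sη 2
  rw [← hH₁] at sH₁
  have dH₁ := differentiableAt_of_contDiffOn ho sH₁
  have dH₁₁ := differentiableAt_of_contDiffOn ho (contDiffOn_pd ho sH₁ 1)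
  -- Since `η_uu = 0`, both `H₁ = η_u` and `H₀ = η - u η_u` are independent of `u`.
  set H₀ : (Fin 3 → ℝ) → ℝ := fun p => eta X p - p 2 * H₁ p with hH₀
  have sH₀ : ContDiffOn ℝ ∞ H₀ (box I J U) :=
    sη.sub ((contDiff_apply ℝ ℝ (2 : Fin 3)).contDiffOn.mul sH₁)
  have dH₀ := differentiableAt_of_contDiffOn ho sH₀
  have dH₀₁ := differentiableAt_of_contDiffOn ho (contDiffOn_pd ho sH₀ 1)
  obtain ⟨t₀, ht₀⟩ := hI.2.nonempty
  obtain ⟨x₀, hx₀⟩ := hJ.2.nonempty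
  obtain ⟨u₀, hu₀⟩ := hU.2.nonempty
  -- independence of variables
  have τ_const : ∀ x ∈ J, ∀ u ∈ U, ∀ t ∈ I, tau X ![t, x, u] = tau X ![t, x₀, u₀] := by
    intro x hx u hu t ht
    trans tau X ![t, x, u₀]
    · exact hU.eq_of_hasDerivAt_zero (f := fun u => tau X ![t, x, u]) (fun u hu => by
        simpa [(D _ (mem_box ht hx hu)).2.1] using hasDerivAt_pd_two (dτ _ (mem_box ht hx hu)))
        hu hu₀
    · exact hJ.eq_of_hasDerivAt_zero (f := fun x => tau X ![t, x, u₀]) (fun x hx => by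
        simpa [(D _ (mem_box ht hx hu₀)).1] using hasDerivAt_pd_one (dτ _ (mem_box ht hx hu₀)))
        hx hx₀
  have τt_const : ∀ x ∈ J, ∀ u ∈ U, ∀ t ∈ I,
      pd 0 (tau X) ![t, x, u] = pd 0 (tau X) ![t, x₀, u₀] := fun x hx u hu =>
    pd_zero_eq_of_eq hI.1 (fun t ht => dτ _ (mem_box ht hx hu))
      (fun t ht => dτ _ (mem_box ht hx₀ hu₀)) (τ_const x hx u hu)
  have H₁_const : ∀ t ∈ I, ∀ x ∈ J, ∀ u ∈ U, H₁ ![t, x, u] = H₁ ![t, x, u₀] :=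
    fun t ht x hx u hu => hU.eq_of_hasDerivAt_zero (f := fun u => H₁ ![t, x, u])
      (fun u hu => by
        simpa [(D _ (mem_box ht hx hu)).2.2.2.1] using hasDerivAt_pd_two (dH₁ _ (mem_box ht hx hu)))
      hu hu₀
  have H₀_const : ∀ t ∈ I, ∀ x ∈ J, ∀ u ∈ U, H₀ ![t, x, u] = H₀ ![t, x, u₀] :=
    fun t ht x hx u hu => hU.eq_of_hasDerivAt_zero (f := fun u => H₀ ![t, x, u])
      (fun u hu => by
        have h1 := hasDerivAt_pd_two (dη _ (mem_box ht hx hu))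
        have h2 := hasDerivAt_pd_two (dH₁ _ (mem_box ht hx hu))
        rw [(D _ (mem_box ht hx hu)).2.2.2.1] at h2
        have h3 := h1.sub ((hasDerivAt_id u).mul h2)
        exact h3.congr_deriv (by rw [← hH₁]; simp))
      hu hu₀
  have η_split : ∀ p ∈ box I J U, eta X p = H₀ p + p 2 * H₁ p := fun p _ => by
    simp [hH₀]
  have ηt : ∀ t ∈ I, ∀ x ∈ J, ∀ u ∈ U, pd 0 (eta X) ![t, x, u] =
      pd 0 H₀ ![t, x, u₀] + u * pd 0 H₁ ![t, x, u₀] := fun t ht x hx u hu =>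
    (hasDerivAt_pd_zero (dη _ (mem_box ht hx hu))).unique
      (((hasDerivAt_pd_zero (dH₀ _ (mem_box ht hx hu₀))).add
        ((hasDerivAt_pd_zero (dH₁ _ (mem_box ht hx hu₀))).const_mul u)).congr_of_eventuallyEq
        (Filter.eventuallyEq_of_mem (hI.1.mem_nhds ht) fun s hs => by
          have := η_split _ (mem_box hs hx hu)
          rw [H₀_const s hs x hx u hu, H₁_const s hs x hx u hu] at this
          simpa using this))
  have ηx : ∀ t ∈ I, ∀ x ∈ J, ∀ u ∈ U, pd 1 (eta X) ![t, x, u] =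
      pd 1 H₀ ![t, x, u₀] + u * pd 1 H₁ ![t, x, u₀] := fun t ht x hx u hu =>
    (hasDerivAt_pd_one (dη _ (mem_box ht hx hu))).unique
      (((hasDerivAt_pd_one (dH₀ _ (mem_box ht hx hu₀))).add
        ((hasDerivAt_pd_one (dH₁ _ (mem_box ht hx hu₀))).const_mul u)).congr_of_eventuallyEq
        (Filter.eventuallyEq_of_mem (hJ.1.mem_nhds hx) fun s hs => by
          have := η_split _ (mem_box ht hs hu)
          rw [H₀_const t ht s hs u hu, H₁_const t ht s hs u hu] at this
          simpa using this))
  have ηxx : ∀ t ∈ I, ∀ x ∈ J, ∀ u ∈ U, pd 1 (pd 1 (eta X)) ![t, x, u] =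
      pd 1 (pd 1 H₀) ![t, x, u₀] + u * pd 1 (pd 1 H₁) ![t, x, u₀] := fun t ht x hx u hu =>
    (hasDerivAt_pd_one (differentiableAt_of_contDiffOn ho (contDiffOn_pd ho sη 1) _
        (mem_box ht hx hu))).unique
      (((hasDerivAt_pd_one (dH₀₁ _ (mem_box ht hx hu₀))).add
        ((hasDerivAt_pd_one (dH₁₁ _ (mem_box ht hx hu₀))).const_mul u)).congr_of_eventuallyEq
        (Filter.eventuallyEq_of_mem (hJ.1.mem_nhds hx) fun s hs => by
          simpa using ηx t ht s hs u hu))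
  -- splitting with respect to `u`
  have S : ∀ t ∈ I, ∀ x ∈ J,
      (2 * c t * H₁ ![t, x, u₀] + c t * pd 0 (tau X) ![t, x₀, u₀]
        + deriv c t * tau X ![t, x₀, u₀] = 0) ∧ H₀ ![t, x, u₀] = 0 ∧
      pd 0 H₁ ![t, x, u₀] - b t * pd 0 (tau X) ![t, x₀, u₀]
        - a t ^ 2 * pd 1 (pd 1 H₁) ![t, x, u₀] - deriv b t * tau X ![t, x₀, u₀] = 0 := by
    intro t ht x hx
    have key := hU.cubic_eq_zero
      (d₃ := 2 * c t * H₁ ![t, x, u₀] + c t * pd 0 (tau X) ![t, x₀, u₀]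
        + deriv c t * tau X ![t, x₀, u₀])
      (d₂ := 3 * c t * H₀ ![t, x, u₀])
      (d₁ := pd 0 H₁ ![t, x, u₀] - b t * pd 0 (tau X) ![t, x₀, u₀]
        - a t ^ 2 * pd 1 (pd 1 H₁) ![t, x, u₀] - deriv b t * tau X ![t, x₀, u₀])
      (d₀ := pd 0 H₀ ![t, x, u₀] - a t ^ 2 * pd 1 (pd 1 H₀) ![t, x, u₀]
        - b t * H₀ ![t, x, u₀])
      (fun u hu => by
        have e := (D _ (mem_box ht hx hu)).2.2.2.2.2.2
        rw [ηt t ht x hx u hu, ηxx t ht x hx u hu, η_split _ (mem_box ht hx hu),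
          H₀_const t ht x hx u hu, H₁_const t ht x hx u hu, τ_const x hx u hu t ht,
          τt_const x hx u hu t ht] at e
        have e0 : (![t, x, u] : Fin 3 → ℝ) 0 = t := rfl
        have e2 : (![t, x, u] : Fin 3 → ℝ) 2 = u := rfl
        rw [e0, e2] at e
        linear_combination e)
    have hc := h.c_ne t ht
    refine ⟨key.1, ?_, key.2.2.1⟩
    have := key.2.1
    simpa [hc] using this
  -- The `u³` coefficient determines `H₁` from functions of `t`, because `c ≠ 0`.
  have H₁_x : ∀ t ∈ I, ∀ x ∈ J, ∀ u ∈ U, H₁ ![t, x, u] = H₁ ![t, x₀, u₀] := by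
    intro t ht x hx u hu
    rw [H₁_const t ht x hx u hu]
    have hc := h.c_ne t ht
    refine mul_left_cancel₀ (mul_ne_zero two_ne_zero hc) ?_
    linear_combination (S t ht x hx).1 - (S t ht x₀ hx₀).1
  have H₁x : ∀ p ∈ box I J U, pd 1 H₁ p = 0 := by
    intro p hp
    rw [← vec_eta p]
    exact (hasDerivAt_pd_one (dH₁ _ (mem_box hp.1 hp.2.1 hp.2.2))).unique
      ((hasDerivAt_const _ (H₁ ![p 0, x₀, u₀])).congr_of_eventuallyEq
        (Filter.eventuallyEq_of_mem (hJ.1.mem_nhds hp.2.1) fun s hs =>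
          H₁_x _ hp.1 s hs _ hp.2.2))
  have H₁xx := pd_eq_zero ho H₁x 1
  have ξx_const : ∀ t ∈ I, ∀ x ∈ J, ∀ u ∈ U,
      pd 1 (xi X) ![t, x, u] = pd 1 (xi X) ![t, x₀, u₀] := by
    intro t ht x hx u hu
    have e1 := (D _ (mem_box ht hx hu)).2.2.2.2.1
    have e2 := (D _ (mem_box ht hx₀ hu₀)).2.2.2.2.1
    rw [τ_const x hx u hu t ht, τt_const x hx u hu t ht] at e1
    exact mul_left_cancel₀ (mul_ne_zero two_ne_zero (pow_ne_zero 2 (h.a_ne t ht)))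
      (e1.trans e2.symm)
  have ξxx : ∀ p ∈ box I J U, pd 1 (pd 1 (xi X)) p = 0 := by
    intro p hp
    rw [← vec_eta p]
    exact (hasDerivAt_pd_one (dξ1 _ (mem_box hp.1 hp.2.1 hp.2.2))).unique
      ((hasDerivAt_const _ (pd 1 (xi X) ![p 0, x₀, u₀])).congr_of_eventuallyEq
        (Filter.eventuallyEq_of_mem (hJ.1.mem_nhds hp.2.1) fun s hs =>
          ξx_const _ hp.1 s hs _ hp.2.2))
  -- From `ξ_t + 2a²η_xu = a²ξ_xx`, where both second derivatives now vanish.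
  have ξt : ∀ p ∈ box I J U, pd 0 (xi X) p = 0 := by
    intro p hp
    have e := (D p hp).2.2.2.2.2.1
    rw [H₁x p hp, ξxx p hp] at e
    linear_combination e
  have ξ_const : ∀ t ∈ I, ∀ u ∈ U, ∀ x ∈ J, xi X ![t, x, u] = xi X ![t₀, x, u₀] := by
    intro t ht u hu x hx
    trans xi X ![t, x, u₀]
    · exact hU.eq_of_hasDerivAt_zero (f := fun u => xi X ![t, x, u]) (fun u hu => by
        simpa [(D _ (mem_box ht hx hu)).2.2.1] using hasDerivAt_pd_two (dξ _ (mem_box ht hx hu)))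
        hu hu₀
    · exact hI.eq_of_hasDerivAt_zero (f := fun t => xi X ![t, x, u₀]) (fun t ht => by
        simpa [ξt _ (mem_box ht hx hu₀)] using hasDerivAt_pd_zero (dξ _ (mem_box ht hx hu₀)))
        ht ht₀
  set k := pd 1 (xi X) ![t₀, x₀, u₀] with hk
  have ξx : ∀ t ∈ I, ∀ x ∈ J, ∀ u ∈ U, pd 1 (xi X) ![t, x, u] = k := fun t ht x hx u hu =>
    (pd_one_eq_of_eq hJ.1 (fun x hx => dξ _ (mem_box ht hx hu))
      (fun x hx => dξ _ (mem_box ht₀ hx hu₀)) (ξ_const t ht u hu) x hx).trans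
      (ξx_const t₀ ht₀ x hx u₀ hu₀)
  set l := xi X ![t₀, x₀, u₀] - k * x₀ with hl
  have ξ_eq : ∀ t ∈ I, ∀ x ∈ J, ∀ u ∈ U, xi X ![t, x, u] = k * x + l := by
    intro t ht x hx u hu
    rw [ξ_const t ht u hu x hx]
    have := hJ.eq_of_hasDerivAt_zero (f := fun x => xi X ![t₀, x, u₀] - k * x) (fun x hx => by
      have e := (hasDerivAt_pd_one (dξ _ (mem_box ht₀ hx hu₀))).sub
        ((hasDerivAt_id x).const_mul k)
      rw [ξx t₀ ht₀ x hx u₀ hu₀] at e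
      exact e.congr_deriv (by simp)) hx hx₀
    rw [hl]; linarith
  set n := a t₀ ^ 2 * tau X ![t₀, x₀, u₀] - 2 * k * T t₀ with hn
  have τ_der : ∀ t ∈ I, a t ^ 2 * pd 0 (tau X) ![t, x₀, u₀] + 2 * a t * deriv a t *
      tau X ![t, x₀, u₀] = 2 * k * a t ^ 2 := fun t ht => by
    have e := (D _ (mem_box ht hx₀ hu₀)).2.2.2.2.1
    rw [ξx t ht x₀ hx₀ u₀ hu₀] at e
    have e0 : (![t, x₀, u₀] : Fin 3 → ℝ) 0 = t := rfl
    rw [e0] at e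
    linear_combination -e
  have τ_eq' : ∀ t ∈ I, a t ^ 2 * tau X ![t, x₀, u₀] = 2 * k * T t + n := by
    intro t ht
    have := hI.eq_of_hasDerivAt_zero
      (f := fun t => a t ^ 2 * tau X ![t, x₀, u₀] - 2 * k * T t) (fun t ht => by
        have e := (((h.differentiableAt ht).1.hasDerivAt.pow 2).mul
          (hasDerivAt_pd_zero (dτ _ (mem_box ht hx₀ hu₀)))).sub ((hT t ht).const_mul (2 * k))
        refine e.congr_deriv ?_
        have := τ_der t ht
        simp
        linear_combination this) ht ht₀
    rw [hn]; linarith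
  have τ_eq : ∀ t ∈ I, tau X ![t, x₀, u₀] = (2 * k * T t + n) / a t ^ 2 := fun t ht => by
    have := h.a_ne t ht
    rw [← τ_eq' t ht]; field_simp
  -- The `u` coefficient, with `H₁` independent of `x`, says that `H₁ - bτ` is constant in `t`; `m`
  -- is its value.
  set m := H₁ ![t₀, x₀, u₀] - b t₀ * tau X ![t₀, x₀, u₀] with hm
  have H₁_eq : ∀ t ∈ I, H₁ ![t, x₀, u₀] = b t * tau X ![t, x₀, u₀] + m := by
    intro t ht
    have := hI.eq_of_hasDerivAt_zero
      (f := fun t => H₁ ![t, x₀, u₀] - b t * tau X ![t, x₀, u₀]) (fun t ht => by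
        have e := (hasDerivAt_pd_zero (dH₁ _ (mem_box ht hx₀ hu₀))).sub
          ((h.differentiableAt ht).2.1.hasDerivAt.mul
          (hasDerivAt_pd_zero (dτ _ (mem_box ht hx₀ hu₀))))
        refine e.congr_deriv ?_
        have := (S t ht x₀ hx₀).2.2
        rw [H₁xx _ (mem_box ht hx₀ hu₀)] at this
        linear_combination this) ht ht₀
    rw [hm]; linarith
  refine ⟨k, l, m, n, fun p hp => ?_, fun t ht => ?_⟩
  · have hη : eta X p = (b (p 0) * ((2 * k * T (p 0) + n) / a (p 0) ^ 2) + m) * p 2 := by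
      rw [η_split p hp, ← vec_eta p, H₀_const _ hp.1 _ hp.2.1 _ hp.2.2,
        (S _ hp.1 _ hp.2.1).2.1, H₁_x _ hp.1 _ hp.2.1 _ hp.2.2, H₁_eq _ hp.1, τ_eq _ hp.1]
      simp
      ring
    ext i
    fin_cases i
    · change tau X p = _
      rw [← vec_eta p, τ_const _ hp.2.1 _ hp.2.2 _ hp.1, τ_eq _ hp.1]
      simp [field]
    · change xi X p = _
      rw [← vec_eta p, ξ_eq _ hp.1 _ hp.2.1 _ hp.2.2]
      simp [field]
    · exact hη
  · have e1 := (S t ht x₀ hx₀).1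
    have e2 := τ_der t ht
    have e3 := τ_eq' t ht
    rw [H₁_eq t ht] at e1
    linear_combination a t ^ 3 * e1 - c t * a t * e2 -
      (deriv c t * a t - 2 * c t * deriv a t + 2 * c t * b t * a t) * e3

end Partial

/-! ### The converse, and the algebra in terms of the multiplier. -/

theorem pd_mul_apply {g : ℝ → ℝ} {p : Fin 3 → ℝ} (hg : DifferentiableAt ℝ g (p 0)) (i : Fin 3) :
    pd i (fun p => g (p 0) * p 2) p =
      deriv g (p 0) * (Pi.single i 1 : Fin 3 → ℝ) 0 * p 2
        + g (p 0) * (Pi.single i 1 : Fin 3 → ℝ) 2 := by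
  have P := fun i => hasFDerivAt_apply (𝕜 := ℝ) (F' := fun _ : Fin 3 => ℝ) i p
  have h := ((hg.hasDerivAt.comp_hasFDerivAt p (P 0)).mul (P 2)).fderiv
  have h' : fderiv ℝ (fun p : Fin 3 → ℝ => g (p 0) * p 2) p = _ := h
  unfold pd
  rw [h']
  simp
  ring

theorem pd_comp_zero {g : ℝ → ℝ} {p : Fin 3 → ℝ} (hg : DifferentiableAt ℝ g (p 0)) (i : Fin 3) :
    pd i (fun p => g (p 0)) p = deriv g (p 0) * (Pi.single i 1 : Fin 3 → ℝ) 0 := by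
  have P := fun i => hasFDerivAt_apply (𝕜 := ℝ) (F' := fun _ : Fin 3 => ℝ) i p
  have h := (hg.hasDerivAt.comp_hasFDerivAt p (P 0)).fderiv
  have h' : fderiv ℝ (fun p : Fin 3 → ℝ => g (p 0)) p = _ := h
  unfold pd
  rw [h']
  simp

theorem pd_affine_one (k l : ℝ) (p : Fin 3 → ℝ) (i : Fin 3) :
    pd i (fun p => k * p 1 + l) p = k * (Pi.single i 1 : Fin 3 → ℝ) 1 := by
  have P := fun i => hasFDerivAt_apply (𝕜 := ℝ) (F' := fun _ : Fin 3 => ℝ) i p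
  have h := (((P 1).const_mul k).add_const l).fderiv
  have h' : fderiv ℝ (fun p : Fin 3 → ℝ => k * p 1 + l) p = _ := h
  unfold pd
  rw [h']
  simp

theorem contDiffOn_of_hasDerivAt {I : Set ℝ} (hI : IsOpen I) {F f : ℝ → ℝ}
    (hf : ContDiffOn ℝ ∞ f I) (hF : ∀ t ∈ I, HasDerivAt F (f t) t) : ContDiffOn ℝ ∞ F I :=
  (contDiffOn_infty_iff_deriv_of_isOpen hI).2
    ⟨fun t ht => (hF t ht).differentiableAt.differentiableWithinAt,
      hf.congr fun t ht => (hF t ht).deriv⟩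

/-- For these fields the criterion cancels identically except for its `u³` term, which is the
hypothesis `hc` divided by `a³`. -/
theorem isLieSymmetry_field {I J U : Set ℝ} {a b c T : ℝ → ℝ} (h : InClass I a b c)
    (hJ : OpenInterval J) (hU : OpenInterval U) (hT : ∀ t ∈ I, HasDerivAt T (a t ^ 2) t)
    {k l m n : ℝ}
    (hc : ∀ t ∈ I, deriv c t * a t * (2 * k * T t + n)
        + 2 * c t * (k * a t ^ 3 - deriv a t * (2 * k * T t + n))
        + 2 * c t * (b t * a t * (2 * k * T t + n) + m * a t ^ 3) = 0) :
    IsLieSymmetry I J U a b c (field a b T k l m n) := by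
  have ho := isOpen_box h.interval.1 hJ.1 hU.1
  set g : ℝ → ℝ := fun t => (2 * k * T t + n) / a t ^ 2 with hg
  set e : ℝ → ℝ := fun t => b t * g t + m with he
  have sT := contDiffOn_of_hasDerivAt h.interval.1 (h.smooth_a.pow 2) hT
  have sg : ContDiffOn ℝ ∞ g I :=
    ((contDiffOn_const.mul sT).add contDiffOn_const).div (h.smooth_a.pow 2)
      fun t ht => pow_ne_zero 2 (h.a_ne t ht)
  have se : ContDiffOn ℝ ∞ e I := (h.smooth_b.mul sg).add contDiffOn_const
  have dg : ∀ t ∈ I, DifferentiableAt ℝ g t := fun t ht =>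
    (sg.contDiffAt (h.interval.1.mem_nhds ht)).differentiableAt (by simp)
  have de : ∀ t ∈ I, DifferentiableAt ℝ e t := fun t ht =>
    (se.contDiffAt (h.interval.1.mem_nhds ht)).differentiableAt (by simp)
  have P := fun i => (contDiff_apply ℝ ℝ (i : Fin 3)).contDiffOn (n := ∞) (s := box I J U)
  have maps : Set.MapsTo (fun p : Fin 3 → ℝ => p 0) (box I J U) I := fun p hp => hp.1
  refine (isLieSymmetry_iff h hJ.1 hU.1 _).2 ⟨contDiffOn_pi.2 fun i => ?_, ?_⟩
  · fin_cases i
    · exact sg.comp (P 0) maps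
    · exact (contDiffOn_const.mul (P 1)).add contDiffOn_const
    · exact (se.comp (P 0) maps).mul (P 2)
  set X := field a b T k l m n with hX
  have eτ : tau X = fun p => g (p 0) := rfl
  have eξ : xi X = fun p => k * p 1 + l := rfl
  have eη : eta X = fun p => e (p 0) * p 2 := rfl
  have τi : ∀ i, ∀ p ∈ box I J U, pd i (tau X) p =
      deriv g (p 0) * (Pi.single i 1 : Fin 3 → ℝ) 0 := fun i p hp => by
    rw [eτ, pd_comp_zero (dg _ hp.1)]
  have ηi : ∀ i, ∀ p ∈ box I J U, pd i (eta X) p =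
      deriv e (p 0) * (Pi.single i 1 : Fin 3 → ℝ) 0 * p 2
        + e (p 0) * (Pi.single i 1 : Fin 3 → ℝ) 2 := fun i p hp => by
    rw [eη, pd_mul_apply (de _ hp.1)]
  have ξi : ∀ i p, pd i (xi X) p = k * (Pi.single i 1 : Fin 3 → ℝ) 1 := fun i p => by
    rw [eξ, pd_affine_one]
  have τ1 : ∀ p ∈ box I J U, pd 1 (tau X) p = 0 := fun p hp => by simp [τi 1 p hp]
  have τ2 : ∀ p ∈ box I J U, pd 2 (tau X) p = 0 := fun p hp => by simp [τi 2 p hp]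
  have η1 : ∀ p ∈ box I J U, pd 1 (eta X) p = 0 := fun p hp => by simp [ηi 1 p hp]
  have η2 : ∀ p ∈ box I J U, pd 2 (eta X) p = e (p 0) := fun p hp => by simp [ηi 2 p hp]
  have ξ1 : pd 1 (xi X) = fun _ => k := by funext p; simp [ξi]
  have ξ2 : pd 2 (xi X) = fun _ => 0 := by funext p; simp [ξi]
  have cst : ∀ (i : Fin 3) (r : ℝ) p, pd i (fun _ => r) p = 0 := fun i r p => by simp [pd]
  intro p hp ux utx uxx
  have η12 : pd 1 (pd 2 (eta X)) p = 0 := by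
    rw [pd_congr ho η2 1 p hp, pd_comp_zero (de _ hp.1)]; simp
  have η22 : pd 2 (pd 2 (eta X)) p = 0 := by
    rw [pd_congr ho η2 2 p hp, pd_comp_zero (de _ hp.1)]; simp
  have a0 := h.a_ne _ hp.1
  have dd := h.differentiableAt hp.1
  have g' : deriv g (p 0) = 2 * k - 2 * deriv a (p 0) * g (p 0) / a (p 0) := by
    have h1 := (((hT _ hp.1).const_mul (2 * k)).add_const n).div (dd.1.hasDerivAt.pow 2)
      (pow_ne_zero 2 a0)
    have h2 : deriv g (p 0) = _ := h1.deriv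
    rw [h2, hg]
    simp
    field_simp
  have e' : deriv e (p 0) = deriv b (p 0) * g (p 0) + b (p 0) * deriv g (p 0) := by
    have h1 := (dd.2.1.hasDerivAt.mul (dg _ hp.1).hasDerivAt).add_const m
    exact h1.deriv
  have hG : 2 * k * T (p 0) + n = a (p 0) ^ 2 * g (p 0) := by
    simp only [hg]; field_simp
  have C := hc _ hp.1
  rw [hG] at C
  have C' : deriv c (p 0) * g (p 0) + 2 * c (p 0) * (k - deriv a (p 0) * g (p 0) / a (p 0))
      + 2 * c (p 0) * e (p 0) = 0 := by
    have : a (p 0) ^ 3 ≠ 0 := pow_ne_zero 3 a0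
    refine (mul_eq_zero.1 ?_).resolve_left this
    simp only [he]
    field_simp
    linear_combination C
  unfold invariance
  rw [pd_eq_zero ho τ1 1 p hp, pd_eq_zero ho τ2 1 p hp, pd_eq_zero ho τ2 2 p hp,
    pd_eq_zero ho η1 1 p hp, η12, η22, η2 p hp, τ1 p hp, τ2 p hp, ξ1, ξ2, cst, cst, cst, ξi 0,
    ηi 0 p hp, τi 0 p hp]
  have vτ : tau X p = g (p 0) := rfl
  have vη : eta X p = e (p 0) * p 2 := rfl
  rw [vτ, vη, e', g']
  simp only [Pi.single_eq_same, ne_eq, Fin.isValue, one_ne_zero, not_false_eq_true,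
    Pi.single_eq_of_ne, Fin.reduceEq, mul_one, mul_zero]
  simp only [he] at C' ⊢
  field_simp at C' ⊢
  linear_combination p 2 ^ 3 * C'

/-- The maximal Lie symmetry algebra, for `c = a² e^{-2B} h`. -/
theorem maxAlgebra_eq {I J U : Set ℝ} {a b c T B h h' : ℝ → ℝ} (H : InClass I a b c)
    (hJ : OpenInterval J) (hU : OpenInterval U) (hT : ∀ t ∈ I, HasDerivAt T (a t ^ 2) t)
    (hB : ∀ t ∈ I, HasDerivAt B (b t) t)
    (hc : ∀ t ∈ I, c t = a t ^ 2 * Real.exp (-2 * B t) * h t)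
    (hh : ∀ t ∈ I, HasDerivAt h (h' t) t) :
    maxAlgebra I J U a b c = {Y | ∃ k l m n : ℝ,
      (∀ t ∈ I, h' t * (2 * k * T t + n) + 2 * (k + m) * a t ^ 2 * h t = 0) ∧
        Y = (box I J U).domRestrict (field a b T k l m n)} := by
  -- The derivatives of the factors `a²` and `e^{-2B}` cancel the terms with `a'` and `b`; a common
  -- nonzero factor `a³ e^{-2B}` remains.
  have key : ∀ k m n : ℝ, ∀ t ∈ I, (deriv c t * a t * (2 * k * T t + n)
        + 2 * c t * (k * a t ^ 3 - deriv a t * (2 * k * T t + n))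
        + 2 * c t * (b t * a t * (2 * k * T t + n) + m * a t ^ 3) = 0 ↔
      h' t * (2 * k * T t + n) + 2 * (k + m) * a t ^ 2 * h t = 0) := by
    intro k m n t ht
    have a0 := H.a_ne t ht
    have h1 := (((H.differentiableAt ht).1.hasDerivAt.pow 2).mul
      ((hB t ht).const_mul (-2)).exp).mul (hh t ht)
    have h2 := (h1.congr_of_eventuallyEq
      (Filter.eventuallyEq_of_mem (H.interval.1.mem_nhds ht) hc)).deriv
    have h3 : a t ^ 3 * Real.exp (-2 * B t) ≠ 0 :=
      mul_ne_zero (pow_ne_zero 3 a0) (Real.exp_ne_zero _)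
    refine Iff.trans ?_ (mul_eq_zero.trans (or_iff_right h3))
    rw [h2, hc t ht]
    refine Eq.congr_left ?_
    simp
    ring
  ext Y
  constructor
  · rintro ⟨X, hX, rfl⟩
    obtain ⟨k, l, m, n, h1, h2⟩ := hX.eq_field H hJ hU hT
    exact ⟨k, l, m, n, fun t ht => (key k m n t ht).1 (h2 t ht),
      funext fun p => h1 p p.2⟩
  · rintro ⟨k, l, m, n, h1, rfl⟩
    exact ⟨_, isLieSymmetry_field H hJ hU hT fun t ht => (key k m n t ht).2 (h1 t ht), rfl⟩

/-! ### The parameters `(k, l, m, n)` as linear coordinates; spans and bases. -/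

section Fields

variable {I J U : Set ℝ} {a b T : ℝ → ℝ}

theorem field_add_smul (r s k l m n k' l' m' n' : ℝ) :
    r • (box I J U).domRestrict (field a b T k l m n) +
      s • (box I J U).domRestrict (field a b T k' l' m' n') =
      (box I J U).domRestrict (field a b T (r * k + s * k') (r * l + s * l') (r * m + s * m')
        (r * n + s * n')) := by
  funext p
  ext i
  fin_cases i <;> simp [field, Set.domRestrict] <;> ring

theorem domRestrict_dx : (box I J U).domRestrict dx =
    (box I J U).domRestrict (field a b T 0 1 0 0) := by
  funext p
  ext i
  fin_cases i <;> simp [field, dx, Set.domRestrict]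

/-- Two distinct values of `x` separate `k` from `l`, then `τ` gives `n`, and a nonzero `u` gives
`m`. -/
theorem field_injective (hI : OpenInterval I) (hJ : OpenInterval J) (hU : OpenInterval U)
    (ha : ∀ t ∈ I, a t ≠ 0) {k l m n k' l' m' n' : ℝ}
    (h : (box I J U).domRestrict (field a b T k l m n) =
      (box I J U).domRestrict (field a b T k' l' m' n')) :
    k = k' ∧ l = l' ∧ m = m' ∧ n = n' := by
  obtain ⟨t, ht⟩ := hI.2.nonempty
  obtain ⟨x, hx⟩ := hJ.2.nonempty
  obtain ⟨x', hx', hne⟩ := hJ.exists_ne x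
  obtain ⟨u, hu, hu0⟩ := hU.exists_ne 0
  have h1 := congrFun h ⟨_, mem_box ht hx hu⟩
  have h2 := congrFun h ⟨_, mem_box ht hx' hu⟩
  have e1 : k * x + l = k' * x + l' := congrFun h1 1
  have e2 : k * x' + l = k' * x' + l' := congrFun h2 1
  have hk : k = k' := by
    have : (k - k') * (x' - x) = 0 := by linear_combination e2 - e1
    exact sub_eq_zero.1 ((mul_eq_zero.1 this).resolve_right (sub_ne_zero.2 hne))
  subst hk
  have e3 : (2 * k * T t + n) / a t ^ 2 = (2 * k * T t + n') / a t ^ 2 := congrFun h1 0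
  have hn : n = n' := by
    have := (div_left_inj' (pow_ne_zero 2 (ha t ht))).1 e3
    linarith
  subst hn
  have e4 : (b t * ((2 * k * T t + n) / a t ^ 2) + m) * u =
    (b t * ((2 * k * T t + n) / a t ^ 2) + m') * u := congrFun h1 2
  have := mul_right_cancel₀ hu0 e4
  exact ⟨rfl, by linarith, by linarith, rfl⟩

theorem spanOn_singleton (X : VectorField) :
    spanOn I J U [X] = {Y | ∃ r : ℝ, Y = r • (box I J U).domRestrict X} := by
  unfold spanOn
  have : (Set.range fun i : Fin [X].length => (box I J U).domRestrict ([X].get i)) =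
      {(box I J U).domRestrict X} := by
    ext Y; simp
  rw [this]
  ext Y
  simp [Submodule.mem_span_singleton, eq_comm]

theorem spanOn_pair (X Y : VectorField) :
    spanOn I J U [X, Y] = {Z | ∃ r s : ℝ, Z = r • (box I J U).domRestrict X +
      s • (box I J U).domRestrict Y} := by
  unfold spanOn
  ext Z
  simp only [SetLike.mem_coe, Submodule.mem_span_range_iff_exists_fun, Set.mem_ofPred_eq]
  constructor
  · rintro ⟨f, rfl⟩
    exact ⟨f 0, f 1, Fin.sum_univ_two _⟩
  · rintro ⟨r, s, rfl⟩
    exact ⟨![r, s], Fin.sum_univ_two _⟩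

theorem spanOn_triple (X Y Z : VectorField) :
    spanOn I J U [X, Y, Z] = {W | ∃ r s q : ℝ, W = r • (box I J U).domRestrict X +
      s • (box I J U).domRestrict Y + q • (box I J U).domRestrict Z} := by
  unfold spanOn
  ext W
  simp only [SetLike.mem_coe, Submodule.mem_span_range_iff_exists_fun, Set.mem_ofPred_eq]
  constructor
  · rintro ⟨f, rfl⟩
    exact ⟨f 0, f 1, f 2, Fin.sum_univ_three _⟩
  · rintro ⟨r, s, q, rfl⟩
    exact ⟨![r, s, q], Fin.sum_univ_three _⟩

theorem isBasisOn_dx (hI : OpenInterval I) (hJ : OpenInterval J) (hU : OpenInterval U)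
    {A : Set (box I J U → (Fin 3 → ℝ))}
    (hA : ∀ Y, Y ∈ A ↔ ∃ l : ℝ, Y = l • (box I J U).domRestrict dx) : IsBasisOn I J U [dx] A := by
  refine ⟨?_, ?_⟩
  · rw [Fintype.linearIndependent_iff]
    intro g hg i
    obtain ⟨t, ht⟩ := hI.2.nonempty
    obtain ⟨x, hx⟩ := hJ.2.nonempty
    obtain ⟨u, hu⟩ := hU.2.nonempty
    have : g 0 • (box I J U).domRestrict dx = 0 := by rw [← hg]; exact (Fin.sum_univ_one
      (fun i : Fin 1 => g i • (box I J U).domRestrict ([dx].get i))).symm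
    have := congrFun (congrFun this ⟨_, mem_box ht hx hu⟩) 1
    have e : g 0 * 1 = 0 := this
    have : i = 0 := Fin.fin_one_eq_zero i
    rw [this]; linarith
  · rw [spanOn_singleton]
    ext Y; exact hA Y

/-- Used when the condition leaves one direction `(k, m, n)` besides the free `l`; `hkn` makes that
direction independent of `∂_x`. -/
theorem isBasisOn_pair (hI : OpenInterval I) (hJ : OpenInterval J) (hU : OpenInterval U)
    (ha : ∀ t ∈ I, a t ≠ 0) {A : Set (box I J U → (Fin 3 → ℝ))} {X : VectorField} {k m n : ℝ}
    (hkn : k ≠ 0 ∨ n ≠ 0)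
    (hX : (box I J U).domRestrict X = (box I J U).domRestrict (field a b T k 0 m n))
    (hA : ∀ Y, Y ∈ A ↔ ∃ r l : ℝ,
      Y = (box I J U).domRestrict (field a b T (r * k) l (r * m) (r * n))) :
    IsBasisOn I J U [dx, X] A := by
  refine ⟨?_, ?_⟩
  · rw [Fintype.linearIndependent_iff]
    intro g hg
    have : g 0 • (box I J U).domRestrict dx + g 1 • (box I J U).domRestrict X = 0 := by
      rw [← hg]; exact (Fin.sum_univ_two
        (fun i : Fin 2 => g i • (box I J U).domRestrict ([dx, X].get i))).symm
    -- Zero is itself written as a combination of fields, so that the parameters of both sides can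
    -- be compared.
    rw [hX, domRestrict_dx (a := a) (b := b) (T := T), field_add_smul,
      show (0 : box I J U → (Fin 3 → ℝ)) = (0 : ℝ) • (box I J U).domRestrict (field a b T 0 0 0 0)
        + (0 : ℝ) • (box I J U).domRestrict (field a b T 0 0 0 0) by simp, field_add_smul] at this
    obtain ⟨e1, e2, e3, e4⟩ := field_injective hI hJ hU ha this
    have h0 : g 0 = 0 := by linarith
    have h1 : g 1 = 0 := by
      rcases hkn with h | h
      · exact (mul_eq_zero.1 (show g 1 * k = 0 by linarith)).resolve_right h
      · exact (mul_eq_zero.1 (show g 1 * n = 0 by linarith)).resolve_right h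
    intro i
    change Fin 2 at i
    fin_cases i
    · exact h0
    · exact h1
  · rw [spanOn_pair]
    ext Y
    rw [hA]
    constructor
    · rintro ⟨r, l, rfl⟩
      refine ⟨l, r, ?_⟩
      rw [hX, domRestrict_dx (a := a) (b := b) (T := T), field_add_smul]
      congr 2 <;> ring
    · rintro ⟨l, r, rfl⟩
      refine ⟨r, l, ?_⟩
      rw [hX, domRestrict_dx (a := a) (b := b) (T := T), field_add_smul]
      congr 2 <;> ring

theorem isBasisOn_triple (hI : OpenInterval I) (hJ : OpenInterval J) (hU : OpenInterval U)
    (ha : ∀ t ∈ I, a t ≠ 0) {A : Set (box I J U → (Fin 3 → ℝ))} {X Y : VectorField}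
    (hX : (box I J U).domRestrict X = (box I J U).domRestrict (field a b T 0 0 0 1))
    (hY : (box I J U).domRestrict Y = (box I J U).domRestrict (field a b T 1 0 (-1) 0))
    (hA : ∀ Y, Y ∈ A ↔ ∃ k l n : ℝ,
      Y = (box I J U).domRestrict (field a b T k l (-k) n)) :
    IsBasisOn I J U [dx, X, Y] A := by
  have comb : ∀ l n k : ℝ, l • (box I J U).domRestrict dx + n • (box I J U).domRestrict X
      + k • (box I J U).domRestrict Y =
        (box I J U).domRestrict (field a b T k l (-k) n) := by
    intro l n k
    rw [hX, hY, domRestrict_dx (a := a) (b := b) (T := T), field_add_smul,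
      ← one_smul ℝ ((box I J U).domRestrict (field a b T (l * 0 + n * 0) _ _ _)), field_add_smul]
    congr 2 <;> ring
  refine ⟨?_, ?_⟩
  · rw [Fintype.linearIndependent_iff]
    intro g hg
    have : g 0 • (box I J U).domRestrict dx + g 1 • (box I J U).domRestrict X
        + g 2 • (box I J U).domRestrict Y = 0 := by
      rw [← hg]; exact (Fin.sum_univ_three
        (fun i : Fin 3 => g i • (box I J U).domRestrict ([dx, X, Y].get i))).symm
    rw [comb, show (0 : box I J U → (Fin 3 → ℝ)) =
        (0 : ℝ) • (box I J U).domRestrict (field a b T 0 0 0 0)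
        + (0 : ℝ) • (box I J U).domRestrict (field a b T 0 0 0 0) by simp, field_add_smul] at this
    obtain ⟨e1, e2, e3, e4⟩ := field_injective hI hJ hU ha this
    intro i
    change Fin 3 at i
    fin_cases i
    · change g 0 = 0; linarith
    · change g 1 = 0; linarith
    · change g 2 = 0; linarith
  · rw [spanOn_triple]
    ext Z
    rw [hA]
    constructor
    · rintro ⟨k, l, n, rfl⟩
      exact ⟨l, n, k, (comb l n k).symm⟩
    · rintro ⟨l, n, k, rfl⟩
      exact ⟨k, l, n, comb l n k⟩

end Fields

/-! ### The equation for the multiplier. -/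

/-- Both signs of `f` are covered at once by `|f|^r = exp (r log f)`, since `Real.log` is even. -/
theorem hasDerivAt_abs_rpow {f : ℝ → ℝ} {f' t : ℝ} (hf : HasDerivAt f f' t) (h0 : f t ≠ 0)
    (r : ℝ) : HasDerivAt (fun s => |f s| ^ r) (r * f' / f t * |f t| ^ r) t := by
  have h1 := ((hf.log h0).mul_const r).exp
  have e : ∀ s, f s ≠ 0 → |f s| ^ r = Real.exp (Real.log (f s) * r) := fun s hs => by
    rw [Real.rpow_def_of_pos (abs_pos.2 hs), Real.log_abs]
  refine (h1.congr_deriv ?_).congr_of_eventuallyEq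
    ((hf.continuousAt.eventually_ne h0).mono fun s hs => e s hs)
  rw [e t h0]; ring

/-- Nonvanishing solutions of `h'(2kT + n) + 2(k + m)T'h = 0`. -/
theorem classify_multiplier {I : Set ℝ} (hI : OpenInterval I) {T q h h' : ℝ → ℝ}
    (hT : ∀ t ∈ I, HasDerivAt T (q t) t) (hq : ∀ t ∈ I, q t ≠ 0)
    (hh : ∀ t ∈ I, HasDerivAt h (h' t) t) (hc : ContinuousOn h' I) (h0 : ∀ t ∈ I, h t ≠ 0)
    {k m n : ℝ} (hkn : k ≠ 0 ∨ n ≠ 0)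
    (H : ∀ t ∈ I, h' t * (2 * k * T t + n) + 2 * (k + m) * q t * h t = 0) :
    (∃ μ γ δ ρ : ℝ, μ ≠ 0 ∧ γ ≠ 0 ∧ ρ ≠ 0 ∧ (∀ t ∈ I, γ * T t + δ ≠ 0) ∧
      ∀ t ∈ I, h t = μ * |γ * T t + δ| ^ ρ) ∨
    (∃ μ σ : ℝ, μ ≠ 0 ∧ σ ≠ 0 ∧ ∀ t ∈ I, h t = μ * Real.exp (σ * T t)) ∨
    (∃ μ : ℝ, μ ≠ 0 ∧ ∀ t ∈ I, h t = μ) := by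
  obtain ⟨t₀, ht₀⟩ := hI.2.nonempty
  have const : (∀ t ∈ I, h' t = 0) → ∃ μ : ℝ, μ ≠ 0 ∧ ∀ t ∈ I, h t = μ := fun e =>
    ⟨h t₀, h0 t₀ ht₀, fun t ht =>
      hI.eq_of_hasDerivAt_zero (fun s hs => e s hs ▸ hh s hs) ht ht₀⟩
  by_cases hk : k = 0
  · subst hk
    have hn : n ≠ 0 := hkn.resolve_left (by simp)
    have e1 : ∀ t ∈ I, h' t = -2 * m / n * q t * h t := fun t ht => by
      have := H t ht
      field_simp
      linear_combination this
    by_cases hm : m = 0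
    · exact Or.inr (Or.inr (const fun t ht => by rw [e1 t ht, hm]; simp))
    -- Here `σ = -2m/n`, and `h e^{-σT}` is constant.
    · refine Or.inr (Or.inl ⟨h t₀ * Real.exp (-(-2 * m / n * T t₀)), -2 * m / n,
        mul_ne_zero (h0 t₀ ht₀) (Real.exp_ne_zero _),
        div_ne_zero (mul_ne_zero (by norm_num) hm) hn, fun t ht => ?_⟩)
      have := hI.eq_of_hasDerivAt_zero
        (f := fun t => h t * Real.exp (-(-2 * m / n * T t))) (fun t ht => by
          have := (hh t ht).mul ((hT t ht).const_mul (-2 * m / n)).neg.exp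
          refine this.congr_deriv ?_
          rw [e1 t ht]
          simp
          ring) ht₀ ht
      rw [this, mul_assoc, ← Real.exp_add]
      simp
  · have dG : ∀ t ∈ I, HasDerivAt (fun t => 2 * k * T t + n) (2 * k * q t) t := fun t ht =>
      ((hT t ht).const_mul (2 * k)).add_const n
    by_cases hm : k + m = 0
    · refine Or.inr (Or.inr (const fun t ht => ?_))
      -- If `h'` were nonzero at a point, it would be so nearby by continuity, forcing `2kT + n` to
      -- vanish there although its derivative does not.
      by_contra hne
      have ev : (fun t => 2 * k * T t + n) =ᶠ[nhds t] fun _ => 0 := by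
        filter_upwards [(hc.continuousAt (hI.1.mem_nhds ht)).eventually_ne hne,
          hI.1.mem_nhds ht] with s hs hsI
        have := H s hsI
        rw [hm] at this
        simpa [hs] using this
      have := (dG t ht).unique ((hasDerivAt_const t (0 : ℝ)).congr_of_eventuallyEq ev)
      exact mul_ne_zero (mul_ne_zero two_ne_zero hk) (hq t ht) this
    -- At a zero of `2kT + n` the equation would make `2(k + m)T'h` vanish. Hence division is
    -- allowed, and `h |2kT + n|^{-ρ}` is constant for `ρ = -(k + m)/k`.
    · have G0 : ∀ t ∈ I, 2 * k * T t + n ≠ 0 := fun t ht e => by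
        have := H t ht
        rw [e, mul_zero, zero_add] at this
        exact mul_ne_zero (mul_ne_zero (mul_ne_zero two_ne_zero hm) (hq t ht)) (h0 t ht) this
      set ρ := -(k + m) / k with hρ
      have pos : ∀ t ∈ I, 0 < |2 * k * T t + n| := fun t ht => abs_pos.2 (G0 t ht)
      refine Or.inl ⟨h t₀ * |2 * k * T t₀ + n| ^ (-ρ), 2 * k, n, ρ,
        mul_ne_zero (h0 t₀ ht₀) (Real.rpow_pos_of_pos (pos t₀ ht₀) _).ne',
        mul_ne_zero two_ne_zero hk, div_ne_zero (neg_ne_zero.2 hm) hk, G0, fun t ht => ?_⟩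
      have := hI.eq_of_hasDerivAt_zero
        (f := fun t => h t * |2 * k * T t + n| ^ (-ρ)) (fun t ht => by
          have e := (hh t ht).mul (hasDerivAt_abs_rpow (dG t ht) (G0 t ht) (-ρ))
          refine e.congr_deriv ?_
          have g0 := G0 t ht
          have : h' t = -(2 * (k + m) * q t * h t) / (2 * k * T t + n) := by
            rw [eq_div_iff g0]; linear_combination H t ht
          rw [this, hρ]
          field_simp
          ring) ht₀ ht
      rw [this, mul_assoc, ← Real.rpow_add (pos t ht)]
      simp

theorem exists_hasDerivAt {I : Set ℝ} (hI : OpenInterval I) {f : ℝ → ℝ} (hf : ContinuousOn f I) :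
    ∃ F : ℝ → ℝ, ∀ t ∈ I, HasDerivAt F (f t) t := by
  obtain ⟨t₀, ht₀⟩ := hI.2.nonempty
  refine ⟨fun t => ∫ s in t₀..t, f s, fun t ht => ?_⟩
  have hsub : Set.uIcc t₀ t ⊆ I := hI.2.isPreconnected.ordConnected.uIcc_subset ht₀ ht
  exact intervalIntegral.integral_hasDerivAt_right (hf.mono hsub).intervalIntegrable
    (hf.stronglyMeasurableAtFilter hI.1 t ht) (hf.continuousAt (hI.1.mem_nhds ht))

theorem OpenInterval.affine_eq_zero {I : Set ℝ} (hI : OpenInterval I) {T q : ℝ → ℝ}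
    (hT : ∀ t ∈ I, HasDerivAt T (q t) t) (hq : ∀ t ∈ I, q t ≠ 0) {α β : ℝ}
    (h : ∀ t ∈ I, α * T t + β = 0) : α = 0 ∧ β = 0 := by
  obtain ⟨t, ht⟩ := hI.2.nonempty
  have h1 := (((hT t ht).const_mul α).add_const β).unique
    ((hasDerivAt_const t (0 : ℝ)).congr_of_eventuallyEq
      (Filter.eventuallyEq_of_mem (hI.1.mem_nhds ht) h))
  have hα : α = 0 := (mul_eq_zero.1 h1).resolve_right (hq t ht)
  refine ⟨hα, ?_⟩
  simpa [hα] using h t ht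

/-! ### Extensions, bases and kernel in the original class. -/

section Multiplier

variable {I J U : Set ℝ} {a b c T B : ℝ → ℝ}

theorem domRestrict_eq_field {k l m n : ℝ} {τ ξ η : (Fin 3 → ℝ) → ℝ}
    (hτ : ∀ p, τ p = (2 * k * T (p 0) + n) / a (p 0) ^ 2) (hξ : ∀ p, ξ p = k * p 1 + l)
    (hη : ∀ p, η p = (b (p 0) * ((2 * k * T (p 0) + n) / a (p 0) ^ 2) + m) * p 2) :
    (box I J U).domRestrict (fun p => ![τ p, ξ p, η p]) =
      (box I J U).domRestrict (field a b T k l m n) := by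
  simp only [hτ, hξ, hη]
  rfl

/-- The multiplier `h = c / (a² e^{-2B})` is the cubic coefficient after gauging to `a = 1`, `b =
0`. -/
theorem InClass.exists_multiplier (H : InClass I a b c) (hB : ∀ t ∈ I, HasDerivAt B (b t) t) :
    ∃ h h' : ℝ → ℝ, (∀ t ∈ I, c t = a t ^ 2 * Real.exp (-2 * B t) * h t) ∧
      (∀ t ∈ I, HasDerivAt h (h' t) t) ∧ ContinuousOn h' I ∧ ∀ t ∈ I, h t ≠ 0 := by
  have sB := contDiffOn_of_hasDerivAt H.interval.1 H.smooth_b hB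
  have w0 : ∀ t ∈ I, a t ^ 2 * Real.exp (-2 * B t) ≠ 0 := fun t ht =>
    mul_ne_zero (pow_ne_zero 2 (H.a_ne t ht)) (Real.exp_ne_zero _)
  have sh : ContDiffOn ℝ ∞ (fun t => c t / (a t ^ 2 * Real.exp (-2 * B t))) I :=
    H.smooth_c.div ((H.smooth_a.pow 2).mul (contDiffOn_const.mul sB).exp) w0
  refine ⟨fun t => c t / (a t ^ 2 * Real.exp (-2 * B t)), _,
    fun t ht => (mul_div_cancel₀ (c t) (w0 t ht)).symm,
    fun t ht => ((sh.contDiffAt (H.interval.1.mem_nhds ht)).differentiableAt (by simp)).hasDerivAt,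
    sh.continuousOn_deriv_of_isOpen H.interval.1 (by simp),
    fun t ht => div_ne_zero (H.c_ne t ht) (w0 t ht)⟩

theorem dx_mem_maxAlgebra (H : InClass I a b c) (hJ : OpenInterval J) (hU : OpenInterval U)
    (r : ℝ) : r • (box I J U).domRestrict dx ∈ maxAlgebra I J U a b c := by
  obtain ⟨T, hT⟩ := exists_hasDerivAt H.interval (H.smooth_a.pow 2).continuousOn
  obtain ⟨B, hB⟩ := exists_hasDerivAt H.interval H.smooth_b.continuousOn
  obtain ⟨h, h', hc, hh, -, -⟩ := H.exists_multiplier hB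
  rw [maxAlgebra_eq H hJ hU hT hB hc hh]
  refine ⟨0, r, 0, 0, fun t _ => by ring, ?_⟩
  rw [domRestrict_dx (a := a) (b := b) (T := T)]
  have := field_add_smul (I := I) (J := J) (U := U) (a := a) (b := b) (T := T)
    r 0 0 1 0 0 0 0 0 0
  simpa using this

/-- The factor `h(T)` of `c = a² e^{-2B} h(T)` in each case. -/
def FullCase.multiplier : FullCase → ℝ → ℝ
  | .power μ γ δ ρ => fun s => μ * |γ * s + δ| ^ ρ
  | .exponential μ σ => fun s => μ * Real.exp (σ * s)
  | .constant μ => fun _ => μ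

theorem FullCase.coeff_eq (k : FullCase) (t : ℝ) :
    k.coeff a T B t = a t ^ 2 * Real.exp (-2 * B t) * k.multiplier (T t) := by
  cases k
  · simp only [coeff, multiplier]; ring
  · simp only [coeff, multiplier]
    rw [show ∀ x y : ℝ, x - 2 * y = -2 * y + x by intros; ring, Real.exp_add]; ring
  · simp only [coeff, multiplier]; ring

/-- In the power and exponential cases the condition reduces to `αT + β = 0` on `I`. As `T' ≠ 0`,
both constants vanish, and these are linear equations for `(k, m, n)`. In the constant case a single
point already gives `m = -k`. -/
theorem FullCase.isBasisOn (H : InClass I a b c)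
    (hJ : OpenInterval J) (hU : OpenInterval U) (hT : ∀ t ∈ I, HasDerivAt T (a t ^ 2) t)
    (hB : ∀ t ∈ I, HasDerivAt B (b t) t) (k : FullCase) (hk : k.Admissible I T)
    (hc : ∀ t ∈ I, c t = k.coeff a T B t) :
    IsBasisOn I J U (k.basis a b T) (maxAlgebra I J U a b c) := by
  have hI := H.interval
  have a2 : ∀ t ∈ I, a t ^ 2 ≠ 0 := fun t ht => pow_ne_zero 2 (H.a_ne t ht)
  have aff := @OpenInterval.affine_eq_zero I hI T (fun t => a t ^ 2) hT a2
  simp only [FullCase.coeff_eq] at hc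
  cases k with
  | power μ γ δ ρ =>
    obtain ⟨hμ, hγ, hρ, hG⟩ := hk
    have hh : ∀ t ∈ I, HasDerivAt (fun t => μ * |γ * T t + δ| ^ ρ)
        (μ * (ρ * (γ * a t ^ 2) / (γ * T t + δ) * |γ * T t + δ| ^ ρ)) t := fun t ht =>
      (hasDerivAt_abs_rpow (((hT t ht).const_mul γ).add_const δ) (hG t ht) ρ).const_mul μ
    rw [maxAlgebra_eq H hJ hU hT hB hc hh]
    refine isBasisOn_pair (T := T) (a := a) (b := b) (k := γ) (m := -(ρ + 1) * γ) (n := 2 * δ)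
      hI hJ hU H.a_ne (Or.inl hγ) ?_ fun Y => ?_
    · exact domRestrict_eq_field (fun p => by ring) (fun p => by ring) fun p => by ring
    have key : ∀ k m n : ℝ, ∀ t ∈ I, (μ * (ρ * (γ * a t ^ 2) / (γ * T t + δ) *
        |γ * T t + δ| ^ ρ) * (2 * k * T t + n) +
          2 * (k + m) * a t ^ 2 * (μ * |γ * T t + δ| ^ ρ) = 0 ↔
        (2 * ρ * γ * k + 2 * (k + m) * γ) * T t + (ρ * γ * n + 2 * (k + m) * δ) = 0) := by
      intro k m n t ht
      have g0 := hG t ht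
      have : μ * a t ^ 2 * |γ * T t + δ| ^ ρ / (γ * T t + δ) ≠ 0 :=
        div_ne_zero (mul_ne_zero (mul_ne_zero hμ (a2 t ht))
          (Real.rpow_pos_of_pos (abs_pos.2 g0) _).ne') g0
      refine Iff.trans ?_ (mul_eq_zero.trans (or_iff_right this))
      refine Eq.congr_left ?_
      field_simp
      ring
    constructor
    · rintro ⟨k, l, m, n, h1, rfl⟩
      obtain ⟨e1, e2⟩ := aff fun t ht => (key k m n t ht).1 (h1 t ht)
      -- The slope gives `m`; then `n = 2δk/γ` requires cancelling `ρ`. This is where `ρ = 0`, with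
      -- its larger algebra, is excluded.
      have hm : m = -(ρ + 1) * k := by
        refine mul_left_cancel₀ hγ ?_
        linear_combination e1 / 2
      subst hm
      have hn : n = 2 * δ * k / γ := by
        rw [eq_div_iff hγ]
        refine mul_left_cancel₀ hρ ?_
        linear_combination e2
      refine ⟨k / γ, l, ?_⟩
      rw [hn]
      congr 2 <;> field_simp
    · rintro ⟨r, l, rfl⟩
      refine ⟨_, _, _, _, fun t ht => (key _ _ _ t ht).2 ?_, rfl⟩
      ring
  | exponential μ σ =>
    obtain ⟨hμ, hσ⟩ := hk
    have hh : ∀ t ∈ I, HasDerivAt (fun t => μ * Real.exp (σ * T t))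
        (μ * (Real.exp (σ * T t) * (σ * a t ^ 2))) t := fun t ht =>
      (((hT t ht).const_mul σ).exp).const_mul μ
    rw [maxAlgebra_eq H hJ hU hT hB hc hh]
    refine isBasisOn_pair (T := T) (a := a) (b := b) (k := 0) (m := -σ) (n := 2)
      hI hJ hU H.a_ne (Or.inr two_ne_zero) ?_ fun Y => ?_
    · exact domRestrict_eq_field (fun p => by ring) (fun p => by ring) fun p => by ring
    have key : ∀ k m n : ℝ, ∀ t ∈ I, (μ * (Real.exp (σ * T t) * (σ * a t ^ 2)) *
        (2 * k * T t + n) + 2 * (k + m) * a t ^ 2 * (μ * Real.exp (σ * T t)) = 0 ↔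
        (2 * σ * k) * T t + (σ * n + 2 * (k + m)) = 0) := by
      intro k m n t ht
      have : μ * a t ^ 2 * Real.exp (σ * T t) ≠ 0 :=
        mul_ne_zero (mul_ne_zero hμ (a2 t ht)) (Real.exp_ne_zero _)
      refine Iff.trans ?_ (mul_eq_zero.trans (or_iff_right this))
      refine Eq.congr_left ?_
      ring
    constructor
    · rintro ⟨k, l, m, n, h1, rfl⟩
      obtain ⟨e1, e2⟩ := aff fun t ht => (key k m n t ht).1 (h1 t ht)
      have hk : k = 0 := (mul_eq_zero.1 e1).resolve_left (mul_ne_zero two_ne_zero hσ)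
      subst hk
      refine ⟨n / 2, l, ?_⟩
      rw [show m = n / 2 * -σ by linear_combination e2 / 2]
      congr 2 <;> ring
    · rintro ⟨r, l, rfl⟩
      refine ⟨_, _, _, _, fun t ht => (key _ _ _ t ht).2 ?_, rfl⟩
      ring
  | constant μ =>
    have hμ : μ ≠ 0 := hk
    have hh : ∀ t ∈ I, HasDerivAt (fun _ : ℝ => μ) 0 t := fun t ht => hasDerivAt_const t μ
    rw [maxAlgebra_eq H hJ hU hT hB hc hh]
    refine isBasisOn_triple (T := T) (a := a) (b := b) hI hJ hU H.a_ne ?_ ?_ fun Y => ?_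
    · exact domRestrict_eq_field (fun p => by ring) (fun p => by ring) fun p => by ring
    · exact domRestrict_eq_field (fun p => by ring) (fun p => by ring) fun p => by ring
    constructor
    · rintro ⟨k, l, m, n, h1, rfl⟩
      obtain ⟨t, ht⟩ := hI.2.nonempty
      have e := h1 t ht
      simp only [FullCase.multiplier] at e
      have hm : m = -k := by
        have : 2 * a t ^ 2 * μ ≠ 0 := mul_ne_zero (mul_ne_zero two_ne_zero (a2 t ht)) hμ
        have : k + m = 0 := (mul_eq_zero.1
          (show (k + m) * (2 * a t ^ 2 * μ) = 0 by linear_combination e)).resolve_right this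
        linarith
      exact ⟨k, l, n, by rw [hm]⟩
    · rintro ⟨k, l, n, rfl⟩
      exact ⟨_, _, _, _, fun t ht => by ring, rfl⟩

theorem dx_notMem_of_field (hI : OpenInterval I) (hJ : OpenInterval J) (hU : OpenInterval U)
    (ha : ∀ t ∈ I, a t ≠ 0) {k l m n : ℝ} (hkn : k ≠ 0 ∨ n ≠ 0) :
    (box I J U).domRestrict (field a b T k l m n) ∉ spanOn I J U [dx] := by
  rw [spanOn_singleton]
  rintro ⟨r, hr⟩
  rw [domRestrict_dx (a := a) (b := b) (T := T)] at hr
  have := field_add_smul (I := I) (J := J) (U := U) (a := a) (b := b) (T := T)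
    r 0 0 1 0 0 0 0 0 0
  rw [zero_smul, add_zero] at this
  rw [this] at hr
  obtain ⟨e1, -, -, e4⟩ := field_injective hI hJ hU ha hr
  rcases hkn with h | h
  · exact h (by simpa using e1)
  · exact h (by simpa using e4)

/-- Each basis contains, right after `∂_x`, an operator with `(k, n) ≠ (0, 0)`, which is no multiple
of `∂_x`. -/
theorem FullCase.hasExtension (H : InClass I a b c)
    (hJ : OpenInterval J) (hU : OpenInterval U) (hT : ∀ t ∈ I, HasDerivAt T (a t ^ 2) t)
    (hB : ∀ t ∈ I, HasDerivAt B (b t) t) (k : FullCase) (hk : k.Admissible I T)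
    (hc : ∀ t ∈ I, c t = k.coeff a T B t) : HasExtension I J U a b c := by
  intro hE
  have hbas := FullCase.isBasisOn H hJ hU hT hB k hk hc
  rw [hE] at hbas
  have hmem : ∀ i : Fin (k.basis a b T).length,
      (box I J U).domRestrict ((k.basis a b T).get i) ∈ spanOn I J U [dx] := fun i => by
    rw [hbas.2]
    exact Submodule.subset_span ⟨i, rfl⟩
  cases k with
  | power μ γ δ ρ =>
    refine dx_notMem_of_field (a := a) (b := b) (T := T) (k := γ) (l := 0) (m := -(ρ + 1) * γ)
      (n := 2 * δ) H.interval hJ hU H.a_ne (Or.inl hk.2.1) ?_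
    convert hmem (1 : Fin 2) using 1
    exact (domRestrict_eq_field (fun p => by ring) (fun p => by ring) fun p => by ring).symm
  | exponential μ σ =>
    refine dx_notMem_of_field (a := a) (b := b) (T := T) (k := 0) (l := 0) (m := -σ)
      (n := 2) H.interval hJ hU H.a_ne (Or.inr two_ne_zero) ?_
    convert hmem (1 : Fin 2) using 1
    exact (domRestrict_eq_field (fun p => by ring) (fun p => by ring) fun p => by ring).symm
  | constant μ =>
    refine dx_notMem_of_field (a := a) (b := b) (T := T) (k := 0) (l := 0) (m := 0)
      (n := 1) H.interval hJ hU H.a_ne (Or.inr one_ne_zero) ?_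
    convert hmem (1 : Fin 3) using 1
    exact (domRestrict_eq_field (fun p => by ring) (fun p => by ring) fun p => by ring).symm

theorem HasExtension.exists_fullCase (H : InClass I a b c)
    (hJ : OpenInterval J) (hU : OpenInterval U) (hT : ∀ t ∈ I, HasDerivAt T (a t ^ 2) t)
    (hB : ∀ t ∈ I, HasDerivAt B (b t) t) (hE : HasExtension I J U a b c) :
    ∃ k : FullCase, k.Admissible I T ∧ ∀ t ∈ I, c t = k.coeff a T B t := by
  have a2 : ∀ t ∈ I, a t ^ 2 ≠ 0 := fun t ht => pow_ne_zero 2 (H.a_ne t ht)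
  obtain ⟨h, h', hc, hh, hcont, h0⟩ := H.exists_multiplier hB
  simp only [FullCase.coeff_eq]
  have hA := maxAlgebra_eq H hJ hU hT hB hc hh
  have hsub : spanOn I J U [dx] ⊆ maxAlgebra I J U a b c := by
    rw [spanOn_singleton]
    rintro _ ⟨r, rfl⟩
    exact dx_mem_maxAlgebra H hJ hU r
  obtain ⟨Y, hY, hYn⟩ := Set.not_subset.1 fun hs => hE (Set.Subset.antisymm hs hsub)
  rw [hA] at hY
  obtain ⟨k, l, m, n, hk, rfl⟩ := hY
  -- With `k = n = 0` the condition reads `2m a² h = 0`, so `m = 0` and the operator is a multiple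
  -- of `∂_x`.
  have hkn : k ≠ 0 ∨ n ≠ 0 := by
    by_contra hcon
    push Not at hcon
    obtain ⟨rfl, rfl⟩ := hcon
    obtain ⟨t, ht⟩ := H.interval.2.nonempty
    have e := hk t ht
    have hm : m = 0 := (mul_eq_zero.1 (show m * (a t ^ 2 * h t) = 0 by
      linear_combination e / 2)).resolve_right (mul_ne_zero (a2 t ht) (h0 t ht))
    subst hm
    apply hYn
    rw [spanOn_singleton]
    refine ⟨l, ?_⟩
    rw [domRestrict_dx (a := a) (b := b) (T := T)]
    have := field_add_smul (I := I) (J := J) (U := U) (a := a) (b := b) (T := T)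
      l 0 0 1 0 0 0 0 0 0
    simpa using this.symm
  rcases classify_multiplier H.interval hT a2 hh hcont h0 hkn hk with
    ⟨μ, γ, δ, ρ, hμ, hγ, hρ, hG, e⟩ | ⟨μ, σ, hμ, hσ, e⟩ | ⟨μ, hμ, e⟩
  · exact ⟨.power μ γ δ ρ, ⟨hμ, hγ, hρ, hG⟩, fun t ht => by
      rw [hc t ht, e t ht]; rfl⟩
  · exact ⟨.exponential μ σ, ⟨hμ, hσ⟩, fun t ht => by rw [hc t ht, e t ht]; rfl⟩
  · exact ⟨.constant μ, hμ, fun t ht => by rw [hc t ht, e t ht]; rfl⟩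

theorem FullCase.inClass (ha : InClass I a b c) (hT : ∀ t ∈ I, HasDerivAt T (a t ^ 2) t)
    (hB : ∀ t ∈ I, HasDerivAt B (b t) t) (k : FullCase) (hk : k.Admissible I T) :
    InClass I a b (k.coeff a T B) := by
  have sT := contDiffOn_of_hasDerivAt ha.interval.1 (ha.smooth_a.pow 2) hT
  have sB := contDiffOn_of_hasDerivAt ha.interval.1 ha.smooth_b hB
  have sm : ContDiffOn ℝ ∞ (fun t => k.multiplier (T t)) I ∧
      ∀ t ∈ I, k.multiplier (T t) ≠ 0 := by
    cases k with
    | power μ γ δ ρ =>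
      obtain ⟨hμ, -, -, hG⟩ := hk
      refine ⟨contDiffOn_const.mul ?_, fun t ht => mul_ne_zero hμ
        (Real.rpow_pos_of_pos (abs_pos.2 (hG t ht)) _).ne'⟩
      have : ContDiffOn ℝ ∞ (fun t => Real.exp (Real.log (γ * T t + δ) * ρ)) I :=
        ((((contDiffOn_const.mul sT).add contDiffOn_const).log hG).mul contDiffOn_const).exp
      refine this.congr fun t ht => ?_
      simp only [Real.rpow_def_of_pos (abs_pos.2 (hG t ht)), Real.log_abs]
    | exponential μ σ =>
      exact ⟨contDiffOn_const.mul (contDiffOn_const.mul sT).exp,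
        fun t ht => mul_ne_zero hk.1 (Real.exp_ne_zero _)⟩
    | constant μ => exact ⟨contDiffOn_const, fun t ht => hk⟩
  refine ⟨ha.interval, ha.smooth_a, ha.smooth_b, ?_, ha.a_ne, fun t ht => ?_⟩
  · exact (((ha.smooth_a.pow 2).mul (contDiffOn_const.mul sB).exp).mul sm.1).congr
      fun t _ => k.coeff_eq t
  · rw [k.coeff_eq]
    exact mul_ne_zero (mul_ne_zero (pow_ne_zero 2 (ha.a_ne t ht)) (Real.exp_ne_zero _)) (sm.2 t ht)

/-- The kernel of the maximal Lie symmetry algebras for fixed `a` and `b`. -/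
theorem isBasisOn_kernel {c₀ : ℝ → ℝ} (H : InClass I a b c₀) (hJ : OpenInterval J)
    (hU : OpenInterval U) : IsBasisOn I J U [dx]
      (⋂ c ∈ {c : ℝ → ℝ | InClass I a b c}, maxAlgebra I J U a b c) := by
  have a2 : ∀ t ∈ I, a t ^ 2 ≠ 0 := fun t ht => pow_ne_zero 2 (H.a_ne t ht)
  obtain ⟨T, hT⟩ := exists_hasDerivAt H.interval (H.smooth_a.pow 2).continuousOn
  obtain ⟨B, hB⟩ := exists_hasDerivAt H.interval H.smooth_b.continuousOn
  refine isBasisOn_dx H.interval hJ hU fun Y => ⟨fun hY => ?_, ?_⟩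
  · simp only [Set.mem_iInter] at hY
    -- Two test equations suffice: `h = 1` forces `m = -k`, after which `h = e^T` forces `2kT + n =
    -- 0`.
    have k₁ := (FullCase.constant 1).inClass H hT hB one_ne_zero
    have k₂ := (FullCase.exponential 1 1).inClass H hT hB ⟨one_ne_zero, one_ne_zero⟩
    have h₁ := hY _ k₁
    have h₂ := hY _ k₂
    rw [maxAlgebra_eq k₁ hJ hU hT hB (fun t _ => FullCase.coeff_eq _ t) (h' := fun _ => 0)
      (fun t _ => hasDerivAt_const t 1)] at h₁
    rw [maxAlgebra_eq k₂ hJ hU hT hB (fun t _ => FullCase.coeff_eq _ t)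
      (fun t ht => (((hT t ht).const_mul 1).exp).const_mul 1)] at h₂
    obtain ⟨k, l, m, n, e₁, rfl⟩ := h₁
    obtain ⟨k', l', m', n', e₂, e⟩ := h₂
    obtain ⟨rfl, rfl, rfl, rfl⟩ := field_injective H.interval hJ hU H.a_ne e
    obtain ⟨t, ht⟩ := H.interval.2.nonempty
    have hm : k + m = 0 := by
      have := e₁ t ht
      simp only [FullCase.multiplier] at this
      exact (mul_eq_zero.1 (show (k + m) * a t ^ 2 = 0 by
        linear_combination this / 2)).resolve_right (a2 t ht)
    obtain ⟨hk, hn⟩ := H.interval.affine_eq_zero hT a2 (α := 2 * k) (β := n) fun t ht => by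
      have := e₂ t ht
      rw [hm] at this
      simpa [H.a_ne t ht] using this
    have hk : k = 0 := by linarith
    subst hk hn
    have hm : m = 0 := by linarith
    subst hm
    refine ⟨l, ?_⟩
    rw [domRestrict_dx (a := a) (b := b) (T := T)]
    have := field_add_smul (I := I) (J := J) (U := U) (a := a) (b := b) (T := T)
      l 0 0 1 0 0 0 0 0 0
    simpa using this.symm
  · rintro ⟨l, rfl⟩
    simp only [Set.mem_iInter]
    exact fun c hc => dx_mem_maxAlgebra hc hJ hU l

end Multiplier

/-! ### Normal forms and the gauged class. -/

/-- Shifts and positive scalings normalise everything but signs: the scalings enter through the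
squares of `δ₁` and `δ₃`, so the signs of `μ` and `σ` survive as `ε` and `s`. -/
theorem FullCase.exists_gaugedCase {I : Set ℝ} {T : ℝ → ℝ} (k : FullCase)
    (hk : k.Admissible I T) :
    ∃ (k' : GaugedCase) (δ₀ δ₁ δ₃ : ℝ), δ₁ ≠ 0 ∧ δ₃ ≠ 0 ∧
      k'.Admissible ((fun t => δ₁ ^ 2 * T t + δ₀) '' I) ∧
      ∀ s, k'.coeff (δ₁ ^ 2 * s + δ₀) = k.multiplier s / (δ₁ ^ 2 * δ₃ ^ 2) := by
  have sgn : ∀ μ : ℝ, μ ≠ 0 → ∃ ε, (ε = 1 ∨ ε = -1) ∧ μ = ε * |μ| := fun μ hμ => by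
    rcases lt_or_gt_of_ne hμ with h | h
    · exact ⟨-1, Or.inr rfl, by rw [abs_of_neg h]; ring⟩
    · exact ⟨1, Or.inl rfl, by rw [abs_of_pos h]; ring⟩
  cases k with
  | power μ γ δ ρ =>
    obtain ⟨hμ, hγ, hρ, hG⟩ := hk
    obtain ⟨ε, hε, e⟩ := sgn μ hμ
    have hp : 0 < |μ| * |γ| ^ ρ :=
      mul_pos (abs_pos.2 hμ) (Real.rpow_pos_of_pos (abs_pos.2 hγ) _)
    refine ⟨.power ε ρ, δ / γ, 1, Real.sqrt (|μ| * |γ| ^ ρ), one_ne_zero,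
      (Real.sqrt_pos.2 hp).ne', ⟨hε, hρ, ?_⟩, fun s => ?_⟩
    · rintro _ ⟨t, ht, rfl⟩ h0
      apply hG t ht
      simp only at h0
      field_simp at h0
      linear_combination h0
    · rw [Real.sq_sqrt hp.le]
      simp only [GaugedCase.coeff, multiplier]
      have : γ * s + δ = γ * (1 ^ 2 * s + δ / γ) := by field_simp
      rw [this, abs_mul, Real.mul_rpow (abs_nonneg _) (abs_nonneg _), one_pow, one_mul,
        one_mul, eq_div_iff hp.ne']
      linear_combination (-|γ| ^ ρ * |s + δ / γ| ^ ρ) * e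
  | exponential μ σ =>
    obtain ⟨hμ, hσ⟩ := hk
    obtain ⟨ε, hε, e⟩ := sgn μ hμ
    obtain ⟨s', hs', es⟩ := sgn σ hσ
    have hp : 0 < |σ| := abs_pos.2 hσ
    have hq : 0 < |μ| / |σ| := div_pos (abs_pos.2 hμ) hp
    -- `δ₁² = |σ|` normalises the exponent, and then `δ₁²δ₃² = |μ|` normalises the factor.
    refine ⟨.exponential ε s', 0, Real.sqrt |σ|, Real.sqrt (|μ| / |σ|), (Real.sqrt_pos.2 hp).ne',
      (Real.sqrt_pos.2 hq).ne', ⟨hε, hs'⟩, fun s => ?_⟩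
    rw [Real.sq_sqrt hp.le, Real.sq_sqrt hq.le, mul_div_cancel₀ _ hp.ne',
      eq_div_iff (abs_pos.2 hμ).ne']
    simp only [GaugedCase.coeff, multiplier]
    rw [show s' * (|σ| * s + 0) = σ * s by linear_combination -s * es]
    linear_combination (-Real.exp (σ * s)) * e
  | constant μ =>
    obtain ⟨ε, hε, e⟩ := sgn μ hk
    have hp : 0 < |μ| := abs_pos.2 hk
    refine ⟨.constant ε, 0, 1, Real.sqrt |μ|, one_ne_zero, (Real.sqrt_pos.2 hp).ne', hε,
      fun s => ?_⟩
    rw [Real.sq_sqrt hp.le, one_pow, one_mul, one_mul, eq_div_iff hp.ne']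
    exact e.symm

/-- The gauged case as a case of the whole class with `a = 1`, `b = 0`. -/
def GaugedCase.full : GaugedCase → FullCase
  | .power ε ρ => .power ε 1 0 ρ
  | .exponential ε s => .exponential ε s
  | .constant ε => .constant ε

theorem GaugedCase.full_coeff (k : GaugedCase) : k.full.coeff 1 id 0 = k.coeff := by
  funext t
  cases k <;> simp [full, coeff, FullCase.coeff]

theorem GaugedCase.full_basis (k : GaugedCase) : k.full.basis 1 0 id = k.basis := by
  cases k <;> simp [full, basis, FullCase.basis]

theorem GaugedCase.Admissible.full {I : Set ℝ} {k : GaugedCase} (hk : k.Admissible I) :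
    k.full.Admissible I id := by
  have ne : ∀ ε : ℝ, ε = 1 ∨ ε = -1 → ε ≠ 0 := by
    rintro ε (rfl | rfl) <;> norm_num
  cases k with
  | power ε ρ =>
    exact ⟨ne ε hk.1, one_ne_zero, hk.2.1, fun t ht => by simpa using hk.2.2 t ht⟩
  | exponential ε s => exact ⟨ne ε hk.1, ne s hk.2⟩
  | constant ε => exact ne ε hk

theorem inClass_one {I : Set ℝ} (hI : OpenInterval I) : InClass I 1 0 1 :=
  ⟨hI, contDiffOn_const, contDiffOn_const, contDiffOn_const, fun _ _ => one_ne_zero,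
    fun _ _ => one_ne_zero⟩

theorem hasDerivAt_id_one (t : ℝ) : HasDerivAt id ((1 : ℝ → ℝ) t ^ 2) t :=
  (hasDerivAt_id t).congr_deriv (by simp)

theorem hasDerivAt_zero_zero (t : ℝ) : HasDerivAt (0 : ℝ → ℝ) ((0 : ℝ → ℝ) t) t :=
  hasDerivAt_const t 0

/-! ### Inequivalence of the listed cases. -/

/-- Preserving `a = 1` forces `θ' = δ₁²`, and preserving `b = 0` forces `φ' = 0`; on an interval `θ`
is then affine and `φ` constant. -/
theorem gaugedEquivalent_of_equivalent {I I' : Set ℝ} {c c' : ℝ → ℝ} (hI : OpenInterval I)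
    (h : Equivalent I 1 0 c I' 1 0 c') : GaugedEquivalent I c I' c' := by
  obtain ⟨θ, φ, δ₁, sθ, sφ, hδ, hne, him, H⟩ := h
  obtain ⟨t₀, ht₀⟩ := hI.2.nonempty
  have dθ : ∀ t ∈ I, deriv θ t = δ₁ ^ 2 := fun t ht => by
    have := (H t ht).1
    simp only [Pi.one_apply, one_pow, mul_one] at this
    rw [eq_div_iff (hne t ht).1] at this
    linarith
  have dφ : ∀ t ∈ I, deriv φ t = 0 := fun t ht => by
    have := (H t ht).2.1
    simp only [Pi.zero_apply, mul_zero, zero_add] at this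
    exact (div_eq_zero_iff.1 this.symm).resolve_right (mul_ne_zero (hne t ht).2 (hne t ht).1)
  have D : ∀ f : ℝ → ℝ, ContDiffOn ℝ ∞ f I → ∀ t ∈ I, HasDerivAt f (deriv f t) t :=
    fun f hf t ht => ((hf.contDiffAt (hI.1.mem_nhds ht)).differentiableAt (by simp)).hasDerivAt
  have eφ : ∀ t ∈ I, φ t = φ t₀ := fun t ht =>
    hI.eq_of_hasDerivAt_zero (fun s hs => dφ s hs ▸ D φ sφ s hs) ht ht₀
  have eθ : ∀ t ∈ I, δ₁ ^ 2 * t + (θ t₀ - δ₁ ^ 2 * t₀) = θ t := fun t ht => by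
    have := hI.eq_of_hasDerivAt_zero (f := fun t => θ t - δ₁ ^ 2 * t) (fun s hs => by
      refine ((D θ sθ s hs).sub ((hasDerivAt_id s).const_mul (δ₁ ^ 2))).congr_deriv ?_
      rw [dθ s hs]; ring) ht ht₀
    linarith
  refine ⟨θ t₀ - δ₁ ^ 2 * t₀, δ₁, φ t₀, hδ, (hne t₀ ht₀).2, ?_, fun t ht => ?_⟩
  · rw [← him]
    exact Set.image_congr eθ
  · rw [eθ t ht, (H t ht).2.2, eφ t ht, dθ t ht, mul_comm]

/-- The sign `ε` of a case. -/
def GaugedCase.sign : GaugedCase → ℝ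
  | .power ε _ => ε
  | .exponential ε _ => ε
  | .constant ε => ε

/-- The logarithmic derivative of the coefficient. -/
def GaugedCase.logDeriv : GaugedCase → ℝ → ℝ
  | .power _ ρ => fun t => ρ / t
  | .exponential _ s => fun _ => s
  | .constant _ => fun _ => 0

theorem GaugedCase.Admissible.sign_eq {I : Set ℝ} {k : GaugedCase} (hk : k.Admissible I) :
    k.sign = 1 ∨ k.sign = -1 := by
  cases k
  exacts [hk.1, hk.1, hk]

theorem GaugedCase.Admissible.coeff_sign {I : Set ℝ} {k : GaugedCase} (hk : k.Admissible I)
    {t : ℝ} (ht : t ∈ I) : ∃ r > 0, k.coeff t = k.sign * r := by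
  cases k with
  | power ε ρ => exact ⟨_, Real.rpow_pos_of_pos (abs_pos.2 (hk.2.2 t ht)) ρ, rfl⟩
  | exponential ε s => exact ⟨_, Real.exp_pos _, rfl⟩
  | constant ε => exact ⟨1, one_pos, (mul_one _).symm⟩

theorem GaugedCase.Admissible.hasDerivAt {I : Set ℝ} {k : GaugedCase} (hk : k.Admissible I)
    {t : ℝ} (ht : t ∈ I) : HasDerivAt k.coeff (k.logDeriv t * k.coeff t) t := by
  cases k with
  | power ε ρ =>
    refine ((hasDerivAt_abs_rpow (hasDerivAt_id t) (hk.2.2 t ht) ρ).const_mul ε).congr_deriv ?_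
    simp only [logDeriv, coeff, id]; ring
  | exponential ε s =>
    refine ((((hasDerivAt_id t).const_mul s).exp).const_mul ε).congr_deriv ?_
    simp only [logDeriv, coeff, id]; ring
  | constant ε =>
    refine (hasDerivAt_const t ε).congr_deriv ?_
    simp only [logDeriv, coeff]; ring

/-- The divisor `δ₁²δ₃²` is positive and constant, so the sign of `c` is invariant and the
logarithmic derivatives satisfy `ℓ'(δ₁²t + δ₀) δ₁² = ℓ(t)`. The candidates `ρ/t`, `±1`, `0` are then
compared pairwise. -/
theorem GaugedCase.eq_of_gaugedEquivalent {I I' : Set ℝ} {k k' : GaugedCase}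
    (hI : OpenInterval I) (hk : k.Admissible I) (hk' : k'.Admissible I')
    (h : GaugedEquivalent I k.coeff I' k'.coeff) : k = k' := by
  obtain ⟨δ₀, δ₁, δ₃, h1, h3, him, H⟩ := h
  have mem : ∀ t ∈ I, δ₁ ^ 2 * t + δ₀ ∈ I' := fun t ht => him ▸ ⟨t, ht, rfl⟩
  obtain ⟨t₀, ht₀⟩ := hI.2.nonempty
  have hd : δ₁ ^ 2 ≠ 0 := pow_ne_zero 2 h1
  have hs : k.sign = k'.sign := by
    obtain ⟨r, hr, e⟩ := hk.coeff_sign ht₀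
    obtain ⟨r', hr', e'⟩ := hk'.coeff_sign (mem t₀ ht₀)
    have E := H t₀ ht₀
    have hp : 0 < δ₁ ^ 2 * δ₃ ^ 2 := by positivity
    rw [e, e', eq_div_iff hp.ne'] at E
    have hq := mul_pos hr' hp
    rcases hk.sign_eq with h | h <;> rcases hk'.sign_eq with h' | h' <;> rw [h, h'] at E ⊢ <;>
      nlinarith
  have L : ∀ t ∈ I, k'.logDeriv (δ₁ ^ 2 * t + δ₀) * δ₁ ^ 2 = k.logDeriv t := fun t ht => by
    have l1 := (hk.hasDerivAt ht).div_const (δ₁ ^ 2 * δ₃ ^ 2)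
    have l2 := (hk'.hasDerivAt (mem t ht)).comp t
      (((hasDerivAt_id t).const_mul (δ₁ ^ 2)).add_const δ₀)
    have l3 := l2.unique (l1.congr_of_eventuallyEq
      (Filter.eventuallyEq_of_mem (hI.1.mem_nhds ht) H))
    rw [mul_div_assoc, ← H t ht] at l3
    obtain ⟨r, hr, e⟩ := hk'.coeff_sign (mem t ht)
    have c0 : k'.coeff (δ₁ ^ 2 * t + δ₀) ≠ 0 := by
      rw [e]
      refine mul_ne_zero ?_ hr.ne'
      rcases hk'.sign_eq with h | h <;> rw [h] <;> norm_num
    refine mul_right_cancel₀ c0 ?_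
    linear_combination l3
  have aff := fun α β => @OpenInterval.affine_eq_zero I hI id (fun _ => 1)
    (fun t _ => hasDerivAt_id t) (fun _ _ => one_ne_zero) α β
  have sne : ∀ s : ℝ, s = 1 ∨ s = -1 → s ≠ 0 := by
    rintro s (rfl | rfl) <;> norm_num
  cases k with
  | power ε ρ =>
    cases k' with
    | power ε' ρ' =>
      obtain rfl : ε = ε' := hs
      -- Clearing denominators in the relation between logarithmic derivatives leaves an identity
      -- affine in `t`, whose slope must vanish.
      have := (aff ((ρ' - ρ) * δ₁ ^ 2) (-ρ * δ₀) fun t ht => by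
        have l := L t ht
        have n1 := hk.2.2 t ht
        have n2 := hk'.2.2 _ (mem t ht)
        simp only [logDeriv] at l
        field_simp at l
        simp only [id]
        linear_combination l).1
      have : ρ' - ρ = 0 := (mul_eq_zero.1 this).resolve_right hd
      rw [sub_eq_zero.1 this]
    | exponential ε' s =>
      have := (aff (s * δ₁ ^ 2) (-ρ) fun t ht => by
        have l := L t ht
        have n1 := hk.2.2 t ht
        simp only [logDeriv] at l
        rw [eq_div_iff n1] at l
        simp only [id]
        linear_combination l).1
      exact absurd this (mul_ne_zero (sne s hk'.2) hd)
    | constant ε' =>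
      have l := L t₀ ht₀
      simp only [logDeriv, zero_mul] at l
      exact absurd l.symm (div_ne_zero hk.2.1 (hk.2.2 t₀ ht₀))
  | exponential ε s =>
    cases k' with
    | power ε' ρ' =>
      have := (aff (s * δ₁ ^ 2) (s * δ₀ - ρ' * δ₁ ^ 2) fun t ht => by
        have l := L t ht
        have n2 := hk'.2.2 _ (mem t ht)
        simp only [logDeriv] at l
        rw [div_mul_eq_mul_div, div_eq_iff n2] at l
        simp only [id]
        linear_combination -l).1
      exact absurd this (mul_ne_zero (sne s hk.2) hd)
    | exponential ε' s' =>
      obtain rfl : ε = ε' := hs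
      have l : s' * δ₁ ^ 2 = s := L t₀ ht₀
      have hp : 0 < δ₁ ^ 2 := by positivity
      have : s = s' := by
        rcases hk.2 with h | h <;> rcases hk'.2 with h' | h' <;> rw [h, h'] at l ⊢ <;> linarith
      rw [this]
    | constant ε' =>
      have l := L t₀ ht₀
      simp only [logDeriv, zero_mul] at l
      exact absurd l.symm (sne s hk.2)
  | constant ε =>
    cases k' with
    | power ε' ρ' =>
      have l := L t₀ ht₀
      simp only [logDeriv] at l
      exact absurd l (mul_ne_zero (div_ne_zero hk'.2.1 (hk'.2.2 _ (mem t₀ ht₀))) hd)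
    | exponential ε' s' =>
      have l := L t₀ ht₀
      simp only [logDeriv] at l
      exact absurd l (mul_ne_zero (sne s' hk'.2) hd)
    | constant ε' =>
      obtain rfl : ε = ε' := hs
      rfl

/-! ### Reduction of extensions to the list. -/

theorem HasExtension.exists_gaugedEquivalent {I J U : Set ℝ} {c : ℝ → ℝ} (H : InClass I 1 0 c)
    (hJ : OpenInterval J) (hU : OpenInterval U) (hE : HasExtension I J U 1 0 c) :
    ∃ (I' : Set ℝ) (k : GaugedCase), k.Admissible I' ∧ GaugedEquivalent I c I' k.coeff := by
  obtain ⟨k, hk, hc⟩ := hE.exists_fullCase H hJ hU (fun t _ => hasDerivAt_id_one t)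
    (fun t _ => hasDerivAt_zero_zero t)
  obtain ⟨k', δ₀, δ₁, δ₃, h1, h3, ha, e⟩ := k.exists_gaugedCase hk
  refine ⟨_, k', ha, δ₀, δ₁, δ₃, h1, h3, rfl, fun t ht => ?_⟩
  rw [e, hc t ht, FullCase.coeff_eq]
  simp

/-- The gauging map `t̃ = T`, `ũ = e^{-B}u` is composed with the normalisation of the multiplier,
which gives `θ = δ₁²T + δ₀` and `φ = δ₃e^{-B}`. -/
theorem HasExtension.exists_equivalent {I J U : Set ℝ} {a b c : ℝ → ℝ} (H : InClass I a b c)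
    (hJ : OpenInterval J) (hU : OpenInterval U) (hE : HasExtension I J U a b c) :
    ∃ (I' : Set ℝ) (k : GaugedCase), k.Admissible I' ∧ Equivalent I a b c I' 1 0 k.coeff := by
  obtain ⟨T, hT⟩ := exists_hasDerivAt H.interval (H.smooth_a.pow 2).continuousOn
  obtain ⟨B, hB⟩ := exists_hasDerivAt H.interval H.smooth_b.continuousOn
  obtain ⟨k, hk, hc⟩ := hE.exists_fullCase H hJ hU hT hB
  obtain ⟨k', δ₀, δ₁, δ₃, h1, h3, ha, e⟩ := k.exists_gaugedCase hk
  have sT := contDiffOn_of_hasDerivAt H.interval.1 (H.smooth_a.pow 2) hT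
  have sB := contDiffOn_of_hasDerivAt H.interval.1 H.smooth_b hB
  have dθ : ∀ t ∈ I, deriv (fun t => δ₁ ^ 2 * T t + δ₀) t = δ₁ ^ 2 * a t ^ 2 := fun t ht =>
    (((hT t ht).const_mul (δ₁ ^ 2)).add_const δ₀).deriv
  have dφ : ∀ t ∈ I, deriv (fun t => δ₃ * Real.exp (-B t)) t =
      δ₃ * (Real.exp (-B t) * -b t) := fun t ht =>
    ((hB t ht).neg.exp.const_mul δ₃).deriv
  have hd : δ₁ ^ 2 ≠ 0 := pow_ne_zero 2 h1
  refine ⟨_, k', ha, fun t => δ₁ ^ 2 * T t + δ₀, fun t => δ₃ * Real.exp (-B t), δ₁,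
    (contDiffOn_const.mul sT).add contDiffOn_const, contDiffOn_const.mul sB.neg.exp, h1,
    fun t ht => ⟨?_, mul_ne_zero h3 (Real.exp_ne_zero _)⟩, rfl, fun t ht => ?_⟩
  · rw [dθ t ht]
    exact mul_ne_zero hd (pow_ne_zero 2 (H.a_ne t ht))
  · have a0 := H.a_ne t ht
    have E0 := Real.exp_ne_zero (-B t)
    refine ⟨?_, ?_, ?_⟩
    · rw [dθ t ht]
      simp
      field_simp
    · rw [dφ t ht, eq_comm, div_eq_iff (mul_ne_zero (mul_ne_zero h3 E0)
        (by rw [dθ t ht]; exact mul_ne_zero hd (pow_ne_zero 2 a0)))]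
      simp
      ring
    · rw [dθ t ht, e, hc t ht, FullCase.coeff_eq,
        show Real.exp (-2 * B t) = Real.exp (-B t) ^ 2 by rw [← Real.exp_nat_mul]; congr 1; push_cast; ring]
      field_simp

end NWS

end

theorem theorem4 :
    -- the kernel of the maximal Lie symmetry algebras of the gauged class
    (∀ I J U : Set ℝ, NWS.OpenInterval I → NWS.OpenInterval J → NWS.OpenInterval U →
      NWS.IsBasisOn I J U [NWS.dx]
        (⋂ c ∈ {c : ℝ → ℝ | NWS.InClass I 1 0 c}, NWS.maxAlgebra I J U 1 0 c)) ∧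
    -- every extension in the gauged class is equivalent to a listed case
    (∀ (I J U : Set ℝ) (c : ℝ → ℝ), NWS.InClass I 1 0 c →
      NWS.OpenInterval J → NWS.OpenInterval U → NWS.HasExtension I J U 1 0 c →
      ∃ (I' : Set ℝ) (k : NWS.GaugedCase), k.Admissible I' ∧
        NWS.GaugedEquivalent I c I' k.coeff) ∧
    -- the listed cases belong to the gauged class, are extensions, and have the listed bases
    (∀ (I J U : Set ℝ) (k : NWS.GaugedCase), NWS.OpenInterval I →
      NWS.OpenInterval J → NWS.OpenInterval U → k.Admissible I →
      NWS.InClass I 1 0 k.coeff ∧ NWS.HasExtension I J U 1 0 k.coeff ∧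
        NWS.IsBasisOn I J U k.basis (NWS.maxAlgebra I J U 1 0 k.coeff)) ∧
    -- different listed cases are inequivalent, for both equivalence groups
    (∀ (I I' : Set ℝ) (k k' : NWS.GaugedCase), NWS.OpenInterval I → NWS.OpenInterval I' →
      k.Admissible I → k'.Admissible I' →
      NWS.GaugedEquivalent I k.coeff I' k'.coeff ∨
        NWS.Equivalent I 1 0 k.coeff I' 1 0 k'.coeff →
      k = k') ∧
    -- the kernel in the original class, for each choice of `a` and `b`
    (∀ (I J U : Set ℝ) (a b : ℝ → ℝ), (∃ c₀ : ℝ → ℝ, NWS.InClass I a b c₀) →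
      NWS.OpenInterval J → NWS.OpenInterval U →
      NWS.IsBasisOn I J U [NWS.dx]
        (⋂ c ∈ {c : ℝ → ℝ | NWS.InClass I a b c}, NWS.maxAlgebra I J U a b c)) ∧
    -- the original class up to its equivalence group
    (∀ (I J U : Set ℝ) (a b c : ℝ → ℝ), NWS.InClass I a b c →
      NWS.OpenInterval J → NWS.OpenInterval U → NWS.HasExtension I J U a b c →
      ∃ (I' : Set ℝ) (k : NWS.GaugedCase), k.Admissible I' ∧
        NWS.Equivalent I a b c I' 1 0 k.coeff) ∧
    -- the original class without gauging
    (∀ (I J U : Set ℝ) (a b c T B : ℝ → ℝ), NWS.InClass I a b c →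
      NWS.OpenInterval J → NWS.OpenInterval U →
      (∀ t ∈ I, HasDerivAt T ((a t) ^ 2) t) → (∀ t ∈ I, HasDerivAt B (b t) t) →
      (NWS.HasExtension I J U a b c ↔
        ∃ k : NWS.FullCase, k.Admissible I T ∧ ∀ t ∈ I, c t = k.coeff a T B t) ∧
      (∀ k : NWS.FullCase, k.Admissible I T → (∀ t ∈ I, c t = k.coeff a T B t) →
        NWS.IsBasisOn I J U (k.basis a b T) (NWS.maxAlgebra I J U a b c))) := by

  open NWS in
  refine ⟨fun I J U hI hJ hU => isBasisOn_kernel (inClass_one hI) hJ hU,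
    fun I J U c H hJ hU hE => hE.exists_gaugedEquivalent H hJ hU,
    fun I J U k hI hJ hU hk => ?_,
    fun I I' k k' hI _ hk hk' h => k.eq_of_gaugedEquivalent hI hk hk'
      (h.elim id (gaugedEquivalent_of_equivalent hI)),
    fun I J U a b ⟨c₀, H⟩ hJ hU => isBasisOn_kernel H hJ hU,
    fun I J U a b c H hJ hU hE => hE.exists_equivalent H hJ hU,
    fun I J U a b c T B H hJ hU hT hB => ⟨⟨fun hE => hE.exists_fullCase H hJ hU hT hB,
      fun ⟨k, hk, hc⟩ => k.hasExtension H hJ hU hT hB hk hc⟩,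
      fun k hk hc => k.isBasisOn H hJ hU hT hB hk hc⟩⟩
  -- The gauged class is the case `a = 1`, `b = 0` with the antiderivatives `T = id` and `B = 0`.
  have hT : ∀ t ∈ I, HasDerivAt id ((1 : ℝ → ℝ) t ^ 2) t := fun t _ => hasDerivAt_id_one t
  have hB : ∀ t ∈ I, HasDerivAt (0 : ℝ → ℝ) ((0 : ℝ → ℝ) t) t := fun t _ => hasDerivAt_zero_zero t
  have hc : ∀ t ∈ I, k.coeff t = k.full.coeff 1 id 0 t := fun t _ => by rw [k.full_coeff]
  have H := k.full.inClass (inClass_one hI) hT hB hk.full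
  rw [k.full_coeff] at H
  have hbas := k.full.isBasisOn H hJ hU hT hB hk.full hc
  rw [k.full_basis] at hbas
  exact ⟨H, k.full.hasExtension H hJ hU hT hB hk.full hc, hbas⟩
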